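/- Let $\mathbf k=\mathbb R$ or $\mathbb C$; manifolds are finite dimensional and smooth (if $\mathbf k=\mathbb R$) or complex (if $\mathbf k=\mathbb C$), and vector fields and bivector fields on them are smooth, respectively holomorphic. Elements of $\wedge^2V$ are skew-symmetric elements of $V\otimes V$, and $v\wedge w=v\otimes w-w\otimes v$. A Lie bialgebra is a finite dimensional Lie algebra $\mathfrak a$ over $\mathbf k$ with a linear map $\delta:\mathfrak a\to\wedge^2\mathfrak a$ whose dual map is a Lie bracket on $\mathfrak a^*$ and such that $\delta[x,y]=[x,\delta(y)]+[\delta(x),y]$. A left (resp. right) $(\mathfrak a,\delta)$-Poisson space is a triple $(Y,\pi,\sigma)$, where $Y$ is a manifold, $\pi$ is a bivector field on $Y$ with vanishing Schouten bracket $[\pi,\pi]=0$, and $\sigma$ is a Lie algebra anti-homomorphism (resp. homomorphism) from $\mathfrak a$ to the vector fields on $Y$ with $[\sigma(x),\pi]=(\sigma\otimes\sigma)(\delta(x))$ for all $x\in\mathfrak a$. If $\mathfrak q$ is a finite dimensional Lie algebra with a non-degenerate symmetric ad-invariant form $\langle\,,\rangle_{\mathfrak q}$ and $\mathfrak q=\mathfrak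 l+\mathfrak l'$ is a splitting into Lagrangian subalgebras, then $\mathfrak l$ is a Lie bialgebra, its co-bracket being the dual map of the bracket of $\mathfrak l'\cong\mathfrak l^*$. The double Lie bialgebra $(\mathfrak q,\delta_{\mathfrak q})$ of the splitting is the Lie bialgebra obtained in this way on $\mathfrak q\cong\mathfrak q_{\rm diag}=\{(a,a):a\in\mathfrak q\}$ from the Lagrangian splitting $\mathfrak q\oplus\mathfrak q=\mathfrak q_{\rm diag}+(\mathfrak l'\oplus\mathfrak l)$, where $\mathfrak q\oplus\mathfrak q$ carries the form $\langle a_1,b_1\rangle_{\mathfrak q}-\langle a_2,b_2\rangle_{\mathfrak q}$. Let $(\mathfrak g,\delta_{\mathfrak g})$ be a Lie bialgebra with dual Lie bialgebra $(\mathfrak g^*,\delta_{\mathfrak g^*})$. Let $\mathfrak d=\mathfrak g\oplus\mathfrak g^*$ be its double Lie algebra, that is, $\mathfrak d$ has the form $\langle x+\xi,y+\eta\rangle_{\mathfrak d}=\langle x,\eta\rangle+\langle\xi,y\rangle$ and the unique Lie bracket extending those of $\mathfrak g$ and $\mathfrak g^*$ for which this form is ad-invariant. Let $(\mathfrak d,\delta_{\mathfrak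 d})$ be the double Lie bialgebra of the splitting $\mathfrak d=\mathfrak g+\mathfrak g^*$. For $n\ge 2$ equip $\mathfrak d^n$ with the direct product bracket and the form $\sum_{j=1}^n(-1)^{j+1}\langle a_j,b_j\rangle_{\mathfrak d}$; it has the Lagrangian splitting $\mathfrak d^n=\mathfrak g_{(n)}+\mathfrak g_{(n)}^*$, where $$\mathfrak g_{(2m)}=(\mathfrak d_{\rm diag})^{m},\quad \mathfrak g_{(2m)}^*=\mathfrak g^*\oplus(\mathfrak d_{\rm diag})^{m-1}\oplus\mathfrak g,\quad \mathfrak g_{(2m-1)}=(\mathfrak d_{\rm diag})^{m-1}\oplus\mathfrak g,\quad \mathfrak g_{(2m-1)}^*=\mathfrak g^*\oplus(\mathfrak d_{\rm diag})^{m-1}.$$ Let $(\mathfrak d^n,\delta_{\mathfrak d^n})$ be the double Lie bialgebra of this splitting. Let $(Y_j,\pi_j,\sigma_j)$, $1\le j\le n$, be left $(\mathfrak d,\delta_{\mathfrak d})$-Poisson spaces, put $\rho_j=-\sigma_j|_{\mathfrak g^*}$ and $\lambda_j=\sigma_j|_{\mathfrak g}$, let $(x_i)$ be any basis of $\mathfrak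 g$ and $(\xi_i)$ the dual basis of $\mathfrak g^*$. On $Y=Y_1\times\cdots\times Y_n$ define $$\pi_Y=(\pi_1,\dots,\pi_n)-\sum_{1\le j<k\le n}\sum_i(0,\dots,\underset{j}{\rho_j(\xi_i)},\dots,0)\wedge(0,\dots,\underset{k}{\lambda_k(x_i)},\dots,0),$$ where $(\pi_1,\dots,\pi_n)$ is the direct product bivector field, and $\sigma(a_1,\dots,a_n)=(\sigma_1(a_1),\dots,\sigma_n(a_n))$ for $(a_1,\dots,a_n)\in\mathfrak d^n$. Then: 1. For each $j$, $(Y_j,\pi_j,\rho_j)$ is a right $(\mathfrak g^*,\delta_{\mathfrak g^*})$-Poisson space and $(Y_j,\pi_j,\lambda_j)$ is a left $(\mathfrak g,\delta_{\mathfrak g})$-Poisson space. 2. $(Y,\pi_Y,\sigma)$ is a left $(\mathfrak d^n,\delta_{\mathfrak d^n})$-Poisson space. 3. For $1\le j<k\le n$, the projection $p_{jk}:Y\to Y_j\times Y_k$ maps $\pi_Y$ to the two-fold mixed product $$\pi_j\times_{(\rho_j,\lambda_k)}\pi_k=(\pi_j,\pi_k)-\sum_i(\rho_j(\xi_i),0)\wedge(0,\lambda_k(x_i)),$$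 that is, $(dp_{jk})_y\,\pi_Y(y)=(\pi_j\times_{(\rho_j,\lambda_k)}\pi_k)(y_j,y_k)$ for all $y\in Y$. -/

import Mathlib

noncomputable section

namespace PoissonLie

open Module

section Tensor

variable {𝕜 V W : Type*} [Field 𝕜] [AddCommGroup V] [Module 𝕜 V] [AddCommGroup W] [Module 𝕜 W]

/-- Contravariant two-tensors on a (finite dimensional) vector space `V`: the tensor product
`V ⊗ V` is identified with the space of bilinear forms on the dual space `V*`, so that
`(v ⊗ w)(α, β) = α v * β w`.  Elements of `∧² V` are the alternating ones among these. -/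
abbrev Tensor2 (𝕜 V : Type*) [Field 𝕜] [AddCommGroup V] [Module 𝕜 V] : Type _ :=
  Dual 𝕜 V →ₗ[𝕜] Dual 𝕜 V →ₗ[𝕜] 𝕜

/-- The map `f ⊗ f : V ⊗ V → W ⊗ W` induced by a linear map `f : V → W`. -/
def Tensor2.map (f : V →ₗ[𝕜] W) (B : Tensor2 𝕜 V) : Tensor2 𝕜 W :=
  B.compl₁₂ f.dualMap f.dualMap

/-- The wedge product `v ∧ w = v ⊗ w - w ⊗ v` of two vectors. -/
def wedge (𝕜 : Type*) {V : Type*} [Field 𝕜] [AddCommGroup V] [Module 𝕜 V] (v w : V) :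
    Tensor2 𝕜 V :=
  LinearMap.mk₂ 𝕜 (fun α β : Dual 𝕜 V => α v * β w - α w * β v)
    (by intros; simp; ring) (by intros; simp; ring) (by intros; simp; ring)
    (by intros; simp; ring)

end Tensor

section Algebra

variable {𝕜 : Type*} [Field 𝕜]

/-- The adjoint action `[x, u ⊗ v] = [x, u] ⊗ v + u ⊗ [x, v]` of a Lie algebra on two-tensors. -/
def adTensor {g : Type*} [LieRing g] [LieAlgebra 𝕜 g] (x : g) (B : Tensor2 𝕜 g) : Tensor2 𝕜 g :=
  B.compl₁₂ (LieAlgebra.ad 𝕜 g x).dualMap LinearMap.id +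
    B.compl₁₂ LinearMap.id (LieAlgebra.ad 𝕜 g x).dualMap

/-- The dual map `g* × g* → g*` of a linear map `δ : g → g ⊗ g`:
`⟨[ξ, η], x⟩ = ⟨ξ ⊗ η, δ x⟩`. -/
def dualBracket {V : Type*} [AddCommGroup V] [Module 𝕜 V] (δ : V →ₗ[𝕜] Tensor2 𝕜 V) :
    Dual 𝕜 V →ₗ[𝕜] Dual 𝕜 V →ₗ[𝕜] Dual 𝕜 V :=
  LinearMap.mk₂ 𝕜 (fun ξ η => (LinearMap.applyₗ η).comp ((LinearMap.applyₗ ξ).comp δ))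
    (by intros; ext; simp) (by intros; ext; simp) (by intros; ext; simp) (by intros; ext; simp)

/-- A Lie bialgebra structure on a (finite dimensional) Lie algebra `g`: a linear co-bracket
`δ : g → ∧² g` whose dual map is a Lie bracket on `g*` and which satisfies the one-cocycle
condition `δ [x, y] = [x, δ y] + [δ x, y]` (where `[δ x, y] = -[y, δ x]`). -/
structure LieBialgebra (𝕜 g : Type*) [Field 𝕜] [LieRing g] [LieAlgebra 𝕜 g] where
  cobracket : g →ₗ[𝕜] Tensor2 𝕜 g
  cobracket_self : ∀ x ξ, cobracket x ξ ξ = 0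
  dual_jacobi : ∀ ξ η ζ : Dual 𝕜 g,
    dualBracket cobracket ξ (dualBracket cobracket η ζ) +
      dualBracket cobracket η (dualBracket cobracket ζ ξ) +
      dualBracket cobracket ζ (dualBracket cobracket ξ η) = 0
  cocycle : ∀ x y : g, cobracket ⁅x, y⁆ =
    adTensor x (cobracket y) - adTensor y (cobracket x)

@[simp] lemma dualBracket_apply {V : Type*} [AddCommGroup V] [Module 𝕜 V]
    (δ : V →ₗ[𝕜] Tensor2 𝕜 V) (ξ η : Dual 𝕜 V) (x : V) : dualBracket δ ξ η x = δ x ξ η := rfl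

@[simp] lemma adTensor_apply {g : Type*} [LieRing g] [LieAlgebra 𝕜 g] (x : g) (B : Tensor2 𝕜 g)
    (ξ η : Dual 𝕜 g) : adTensor x B ξ η =
      B (ξ ∘ₗ LieAlgebra.ad 𝕜 g x) η +
      B ξ (η ∘ₗ LieAlgebra.ad 𝕜 g x) := rfl

namespace LieBialgebra

variable {g : Type*} [LieRing g] [LieAlgebra 𝕜 g]

lemma cobracket_swap (B : LieBialgebra 𝕜 g) (x : g) (ξ η : Dual 𝕜 g) :
    B.cobracket x ξ η = -B.cobracket x η ξ := by
  have h := B.cobracket_self x (ξ + η)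
  simp only [map_add, LinearMap.add_apply, B.cobracket_self] at h
  linear_combination h

/-- The co-bracket `(e ⊗ e) ∘ δ ∘ e⁻¹`, for an isomorphism `e`. -/
def congrCobracket {h : Type*} [LieRing h] [LieAlgebra 𝕜 h] (B : LieBialgebra 𝕜 g)
    (e : g ≃ₗ⁅𝕜⁆ h) : h →ₗ[𝕜] Tensor2 𝕜 h where
  toFun y := Tensor2.map e.toLinearEquiv.toLinearMap (B.cobracket (e.symm y))
  map_add' := by intros; ext; simp [Tensor2.map]
  map_smul' := by intros; ext; simp [Tensor2.map]

lemma congrCobracket_apply {h : Type*} [LieRing h] [LieAlgebra 𝕜 h] (B : LieBialgebra 𝕜 g)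
    (e : g ≃ₗ⁅𝕜⁆ h) (y : h) (ξ η : Dual 𝕜 h) : B.congrCobracket e y ξ η =
      B.cobracket (e.symm y) (e.toLinearEquiv.toLinearMap.dualMap ξ)
        (e.toLinearEquiv.toLinearMap.dualMap η) := rfl

/-- The Lie bialgebra structure transported along an isomorphism of Lie algebras. -/
def congr {h : Type*} [LieRing h] [LieAlgebra 𝕜 h] (B : LieBialgebra 𝕜 g) (e : g ≃ₗ⁅𝕜⁆ h) :
    LieBialgebra 𝕜 h where
  cobracket := B.congrCobracket e
  cobracket_self := fun x ξ => B.cobracket_self _ _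
  dual_jacobi := fun ξ η ζ => by
    ext y
    have key : ∀ φ ψ : Dual 𝕜 h,
        e.toLinearEquiv.toLinearMap.dualMap (dualBracket (B.congrCobracket e) φ ψ) =
        dualBracket B.cobracket (e.toLinearEquiv.toLinearMap.dualMap φ)
          (e.toLinearEquiv.toLinearMap.dualMap ψ) := by
      intro φ ψ; ext w; simp [congrCobracket_apply]
    have h := LinearMap.congr_fun (B.dual_jacobi (e.toLinearEquiv.toLinearMap.dualMap ξ)
      (e.toLinearEquiv.toLinearMap.dualMap η) (e.toLinearEquiv.toLinearMap.dualMap ζ)) (e.symm y)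
    simp only [LinearMap.add_apply, dualBracket_apply, LinearMap.zero_apply] at h
    simp only [LinearMap.add_apply, dualBracket_apply, LinearMap.zero_apply,
      congrCobracket_apply, key]
    exact h
  cocycle := fun x y => by
    ext ξ η
    have key : ∀ (z : h) (φ : Dual 𝕜 h),
        e.toLinearEquiv.toLinearMap.dualMap (φ ∘ₗ LieAlgebra.ad 𝕜 h z) =
        e.toLinearEquiv.toLinearMap.dualMap φ ∘ₗ LieAlgebra.ad 𝕜 g (e.symm z) := by
      intro z φ; ext w; simp [LieEquiv.map_lie]
    have h2 : e.symm ⁅x, y⁆ = ⁅e.symm x, e.symm y⁆ := LieEquiv.map_lie _ _ _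
    simp [congrCobracket_apply, key, h2, B.cocycle]

/-- The dual space `g*` of a Lie bialgebra `g`, as a Lie algebra. -/
def DualLie (_B : LieBialgebra 𝕜 g) : Type _ := Dual 𝕜 g

variable (B : LieBialgebra 𝕜 g)

instance : AddCommGroup B.DualLie := inferInstanceAs (AddCommGroup (Dual 𝕜 g))
instance : Module 𝕜 B.DualLie := inferInstanceAs (Module 𝕜 (Dual 𝕜 g))
instance [FiniteDimensional 𝕜 g] : FiniteDimensional 𝕜 B.DualLie :=
  inferInstanceAs (FiniteDimensional 𝕜 (Dual 𝕜 g))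

/-- The identity map from `g*` to `g*` as a Lie algebra. -/
def toDualLie : Dual 𝕜 g ≃ₗ[𝕜] B.DualLie := LinearEquiv.refl 𝕜 (Dual 𝕜 g)

instance : LieRing B.DualLie where
  bracket ξ η := B.toDualLie (dualBracket B.cobracket (B.toDualLie.symm ξ) (B.toDualLie.symm η))
  add_lie := by intros; simp [map_add]
  lie_add := by intros; simp [map_add]
  lie_self := by
    intro ξ
    apply B.toDualLie.symm.injective
    ext x
    simpa using B.cobracket_self x _
  leibniz_lie := by
    intro ξ η ζ
    apply B.toDualLie.symm.injective
    ext x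
    have h := LinearMap.congr_fun (B.dual_jacobi (B.toDualLie.symm ξ) (B.toDualLie.symm η)
      (B.toDualLie.symm ζ)) x
    simp only [LinearMap.add_apply, dualBracket_apply, LinearMap.zero_apply] at h
    simp only [LinearEquiv.symm_apply_apply, map_add, LinearMap.add_apply, dualBracket_apply]
    have h1 := B.cobracket_swap x (dualBracket B.cobracket (B.toDualLie.symm ξ)
      (B.toDualLie.symm η)) (B.toDualLie.symm ζ)
    have h2 : dualBracket B.cobracket (B.toDualLie.symm ζ) (B.toDualLie.symm ξ) =
      - dualBracket B.cobracket (B.toDualLie.symm ξ) (B.toDualLie.symm ζ) := by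
      ext y; exact B.cobracket_swap y _ _
    rw [h2, map_neg] at h
    linear_combination h - h1

lemma dualLie_bracket (ξ η : B.DualLie) : ⁅ξ, η⁆ =
    B.toDualLie (dualBracket B.cobracket (B.toDualLie.symm ξ) (B.toDualLie.symm η)) := rfl

instance : LieAlgebra 𝕜 B.DualLie where
  lie_smul := by intros; simp [dualLie_bracket]

/-- The canonical isomorphism `g ≅ g**`. -/
def bidual [FiniteDimensional 𝕜 g] : g ≃ₗ[𝕜] Dual 𝕜 B.DualLie :=
  (evalEquiv 𝕜 g).trans B.toDualLie.symm.dualMap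

@[simp] lemma bidual_apply [FiniteDimensional 𝕜 g] (x : g) (ξ : B.DualLie) :
    B.bidual x ξ = B.toDualLie.symm ξ x := rfl

/-- The dual map `g* → g* ⊗ g*` of the Lie bracket of `g`,
`δ(ξ)(x, y) = ⟨ξ, [x, y]⟩` for `x, y ∈ g ≅ g**`. -/
def dualCobracket [FiniteDimensional 𝕜 g] : B.DualLie →ₗ[𝕜] Tensor2 𝕜 B.DualLie where
  toFun ξ := LinearMap.mk₂ 𝕜
    (fun Φ Ψ => B.toDualLie.symm ξ ⁅B.bidual.symm Φ, B.bidual.symm Ψ⁆)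
    (by intros; simp) (by intros; simp) (by intros; simp) (by intros; simp)
  map_add' := by intros; ext; simp
  map_smul' := by intros; ext; simp

lemma dualCobracket_apply [FiniteDimensional 𝕜 g] (ξ : B.DualLie) (Φ Ψ : Dual 𝕜 B.DualLie) :
    B.dualCobracket ξ Φ Ψ = B.toDualLie.symm ξ ⁅B.bidual.symm Φ, B.bidual.symm Ψ⁆ := rfl

/-- The dual Lie bialgebra `g*`. -/
def dual [FiniteDimensional 𝕜 g] : LieBialgebra 𝕜 B.DualLie where
  cobracket := B.dualCobracket
  cobracket_self := by intros; simp [dualCobracket_apply]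
  dual_jacobi := by
    intro Φ Ψ Θ
    obtain ⟨x, rfl⟩ := B.bidual.surjective Φ
    obtain ⟨y, rfl⟩ := B.bidual.surjective Ψ
    obtain ⟨z, rfl⟩ := B.bidual.surjective Θ
    have key : ∀ a b, dualBracket B.dualCobracket (B.bidual a) (B.bidual b) = B.bidual ⁅a, b⁆ := by
      intro a b; ext ξ; simp [dualCobracket_apply]
    rw [key, key, key, key, key, key, ← map_add, ← map_add, lie_jacobi, map_zero]
  cocycle := by
    intro ξ η
    ext Φ Ψ
    obtain ⟨x, rfl⟩ := B.bidual.surjective Φ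
    obtain ⟨y, rfl⟩ := B.bidual.surjective Ψ
    have h1 : ∀ (Φ : Dual 𝕜 B.DualLie) (ζ : Dual 𝕜 g),
        ζ (B.bidual.symm Φ) = Φ (B.toDualLie ζ) := by
      intro Φ ζ
      obtain ⟨z, rfl⟩ := B.bidual.surjective Φ
      simp
    have key2 : ∀ (ξ : B.DualLie) (x y : g) (η : B.DualLie),
        B.toDualLie.symm η ⁅y, B.bidual.symm (B.bidual x ∘ₗ LieAlgebra.ad 𝕜 B.DualLie ξ)⁆ =
        B.cobracket x (B.toDualLie.symm ξ) (B.toDualLie.symm η ∘ₗ LieAlgebra.ad 𝕜 g y) := by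
      intro ξ x y η
      have := h1 (B.bidual x ∘ₗ LieAlgebra.ad 𝕜 B.DualLie ξ)
        (B.toDualLie.symm η ∘ₗ LieAlgebra.ad 𝕜 g y)
      simpa [dualLie_bracket] using this
    have key : ∀ (ξ : B.DualLie) (x y : g) (η : B.DualLie),
        B.toDualLie.symm η ⁅B.bidual.symm (B.bidual x ∘ₗ LieAlgebra.ad 𝕜 B.DualLie ξ), y⁆ =
        - B.cobracket x (B.toDualLie.symm ξ) (B.toDualLie.symm η ∘ₗ LieAlgebra.ad 𝕜 g y) := by
      intro ξ x y η
      rw [← lie_skew, map_neg, key2]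
    simp only [dualCobracket_apply, LinearMap.sub_apply,
      adTensor_apply, key, key2, LinearEquiv.symm_apply_apply, dualLie_bracket,
      dualBracket_apply, B.cocycle]
    rw [B.cobracket_swap x (B.toDualLie.symm ξ ∘ₗ _), B.cobracket_swap y (B.toDualLie.symm ξ ∘ₗ _)]
    ring

/-- The coadjoint action of `g` on `g*`: `⟨ad*_x ξ, y⟩ = ⟨ξ, [y, x]⟩`. -/
def coad (x : g) (ξ : B.DualLie) : B.DualLie :=
  -B.toDualLie (B.toDualLie.symm ξ ∘ₗ LieAlgebra.ad 𝕜 g x)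

@[simp] lemma coad_apply (x y : g) (ξ : B.DualLie) :
    B.toDualLie.symm (B.coad x ξ) y = B.toDualLie.symm ξ ⁅y, x⁆ := by
  simp only [coad, map_neg, LinearEquiv.symm_apply_apply, LinearMap.neg_apply,
    LinearMap.comp_apply, LieAlgebra.ad_apply]
  rw [← lie_skew y x, map_neg]

/-- The underlying space `g ⊕ g*` of the double of a Lie bialgebra `g`. -/
def Double (B : LieBialgebra 𝕜 g) : Type _ := g × B.DualLie

instance : AddCommGroup B.Double := inferInstanceAs (AddCommGroup (g × B.DualLie))
instance : Module 𝕜 B.Double := inferInstanceAs (Module 𝕜 (g × B.DualLie))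
variable {B}

@[simp] lemma Double.fst_add (a b : B.Double) : (a + b).1 = a.1 + b.1 := rfl
@[simp] lemma Double.snd_add (a b : B.Double) : (a + b).2 = a.2 + b.2 := rfl
@[simp] lemma Double.fst_zero : (0 : B.Double).1 = 0 := rfl
@[simp] lemma Double.snd_zero : (0 : B.Double).2 = 0 := rfl
@[simp] lemma Double.fst_smul (c : 𝕜) (a : B.Double) : (c • a).1 = c • a.1 := rfl
@[simp] lemma Double.snd_smul (c : 𝕜) (a : B.Double) : (c • a).2 = c • a.2 := rfl

variable (B)

variable [FiniteDimensional 𝕜 g]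

/-- The coadjoint action of `g*` on `g`: `⟨ad*_ξ x, η⟩ = ⟨x, [η, ξ]⟩`. -/
def coad' (ξ : B.DualLie) (x : g) : g :=
  (evalEquiv 𝕜 g).symm ((B.cobracket x).flip (B.toDualLie.symm ξ))

@[simp] lemma apply_coad' (x : g) (ξ : B.DualLie) (η : Dual 𝕜 g) :
    η (B.coad' ξ x) = B.cobracket x η (B.toDualLie.symm ξ) := by
  have : evalEquiv 𝕜 g (B.coad' ξ x) = (B.cobracket x).flip (B.toDualLie.symm ξ) :=
    LinearEquiv.apply_symm_apply _ _
  exact LinearMap.congr_fun this η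

instance : FiniteDimensional 𝕜 B.Double :=
  inferInstanceAs (FiniteDimensional 𝕜 (g × B.DualLie))

variable {B}

lemma eq_of_forall_dual {x y : g} (h : ∀ ξ : Dual 𝕜 g, ξ x = ξ y) : x = y :=
  (evalEquiv 𝕜 g).injective (LinearMap.ext h)

lemma Double.ext {a b : B.Double} (h1 : ∀ ξ : Dual 𝕜 g, ξ a.1 = ξ b.1)
    (h2 : ∀ x : g, B.toDualLie.symm a.2 x = B.toDualLie.symm b.2 x) : a = b :=
  Prod.ext (eq_of_forall_dual h1) (B.toDualLie.symm.injective (LinearMap.ext h2))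

/-- The Lie bracket of the double:
`[x + ξ, y + η] = [x, y] + ad*_ξ y - ad*_η x + [ξ, η] + ad*_x η - ad*_y ξ`. -/
instance : Bracket B.Double B.Double where
  bracket a b := (⁅a.1, b.1⁆ + B.coad' a.2 b.1 - B.coad' b.2 a.1,
    ⁅a.2, b.2⁆ + B.coad a.1 b.2 - B.coad b.1 a.2)

@[simp] lemma Double.apply_fst_bracket (a b : B.Double) (ζ : Dual 𝕜 g) :
    ζ ⁅a, b⁆.1 = ζ ⁅a.1, b.1⁆ + B.cobracket b.1 ζ (B.toDualLie.symm a.2)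
      - B.cobracket a.1 ζ (B.toDualLie.symm b.2) := by
  change ζ (_ + _ - _) = _
  simp

@[simp] lemma Double.snd_bracket_apply (a b : B.Double) (z : g) :
    B.toDualLie.symm ⁅a, b⁆.2 z =
      B.cobracket z (B.toDualLie.symm a.2) (B.toDualLie.symm b.2) +
      B.toDualLie.symm b.2 ⁅z, a.1⁆ - B.toDualLie.symm a.2 ⁅z, b.1⁆ := by
  change B.toDualLie.symm (_ + _ - _) z = _
  simp [dualLie_bracket]

lemma Double.snd_bracket (a b : B.Double) : B.toDualLie.symm ⁅a, b⁆.2 =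
      dualBracket B.cobracket (B.toDualLie.symm a.2) (B.toDualLie.symm b.2) -
      B.toDualLie.symm b.2 ∘ₗ LieAlgebra.ad 𝕜 g a.1 +
      B.toDualLie.symm a.2 ∘ₗ LieAlgebra.ad 𝕜 g b.1 := by
  ext z
  simp only [Double.snd_bracket_apply, LinearMap.add_apply, LinearMap.sub_apply,
    dualBracket_apply, LinearMap.comp_apply, LieAlgebra.ad_apply]
  rw [← lie_skew z a.1, ← lie_skew z b.1, map_neg, map_neg]
  ring

lemma Double.fst_bracket (a b : B.Double) :
    ⁅a, b⁆.1 = ⁅a.1, b.1⁆ + B.coad' a.2 b.1 - B.coad' b.2 a.1 := rfl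

lemma cobracket_coad' (x : g) (ξ : B.DualLie) (η ω : Dual 𝕜 g) :
    B.cobracket (B.coad' ξ x) η ω =
      B.cobracket x (dualBracket B.cobracket η ω) (B.toDualLie.symm ξ) :=
  B.apply_coad' x ξ (dualBracket B.cobracket η ω)

lemma apply_lie_coad' (x y : g) (ξ : B.DualLie) (ζ : Dual 𝕜 g) : ζ ⁅y, B.coad' ξ x⁆ =
    B.cobracket x (ζ ∘ₗ LieAlgebra.ad 𝕜 g y) (B.toDualLie.symm ξ) :=
  B.apply_coad' x ξ (ζ ∘ₗ LieAlgebra.ad 𝕜 g y)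

lemma apply_lie_coad'_left (x y : g) (ξ : B.DualLie) (ζ : Dual 𝕜 g) : ζ ⁅B.coad' ξ x, y⁆ =
    -B.cobracket x (ζ ∘ₗ LieAlgebra.ad 𝕜 g y) (B.toDualLie.symm ξ) := by
  rw [← lie_skew, map_neg, apply_lie_coad']

set_option linter.unusedSimpArgs false in
instance : LieRing B.Double where
  add_lie a b c := by
    apply Double.ext <;> intro z <;> simp <;> ring
  lie_add a b c := by
    apply Double.ext <;> intro z <;> simp <;> ring
  lie_self a := by
    apply Double.ext <;> intro z
    · simp
    · simp [B.cobracket_self]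
  leibniz_lie a b c := by
    have jac : ∀ (x : g) (φ ψ χ : Dual 𝕜 g), B.cobracket x φ (dualBracket B.cobracket ψ χ) =
        B.cobracket x (dualBracket B.cobracket φ ψ) χ +
          B.cobracket x ψ (dualBracket B.cobracket φ χ) := by
      intro x φ ψ χ
      have := leibniz_lie (B.toDualLie φ) (B.toDualLie ψ) (B.toDualLie χ)
      exact LinearMap.congr_fun (congrArg B.toDualLie.symm this) x
    have swp : ∀ (x y : g) (φ ψ : Dual 𝕜 g), B.cobracket x (φ ∘ₗ LieAlgebra.ad 𝕜 g y) ψ =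
        -B.cobracket x ψ (φ ∘ₗ LieAlgebra.ad 𝕜 g y) := fun x y φ ψ => B.cobracket_swap x _ _
    have lj : ∀ (φ : Dual 𝕜 g) (u v w : g), φ ⁅⁅u, v⁆, w⁆ = φ ⁅u, ⁅v, w⁆⁆ - φ ⁅v, ⁅u, w⁆⁆ := by
      intro φ u v w
      rw [lie_lie, map_sub]
    apply Double.ext <;> intro z
    · simp only [Double.apply_fst_bracket, Double.snd_bracket, Double.fst_bracket,
        Double.fst_add, map_add, map_sub, LinearMap.add_apply, LinearMap.sub_apply,
        lie_add, lie_sub, add_lie, sub_lie, apply_coad',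
        cobracket_coad', apply_lie_coad', apply_lie_coad'_left, B.cocycle, adTensor_apply]
      generalize B.toDualLie.symm a.2 = ξ, B.toDualLie.symm b.2 = η,
        B.toDualLie.symm c.2 = ζ, a.1 = x, b.1 = y, c.1 = w
      simp only [lj, swp]
      have e1 := jac x z η ζ
      have e2 := jac y z ξ ζ
      have e3 := jac w z ξ η
      have e4 := B.cobracket_swap x (dualBracket B.cobracket z ζ) η
      have e5 := B.cobracket_swap y (dualBracket B.cobracket z ζ) ξ
      have e6 := B.cobracket_swap w (dualBracket B.cobracket z η) ξ
      grind
    · simp only [Double.snd_bracket_apply, Double.snd_bracket, Double.fst_bracket,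
        Double.snd_add, map_add, map_sub, LinearMap.add_apply, LinearMap.sub_apply,
        lie_add, lie_sub, add_lie, sub_lie, LinearMap.comp_apply, LieAlgebra.ad_apply,
        cobracket_coad', apply_lie_coad', apply_lie_coad'_left, B.cocycle, adTensor_apply,
        dualBracket_apply]
      generalize B.toDualLie.symm a.2 = ξ, B.toDualLie.symm b.2 = η,
        B.toDualLie.symm c.2 = ζ, a.1 = x, b.1 = y, c.1 = w
      simp only [lj, swp, jac z ξ η ζ]
      have e2 : ∀ (φ : Dual 𝕜 g) (u v w : g), φ ⁅u, ⁅v, w⁆⁆ = - φ ⁅u, ⁅w, v⁆⁆ := by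
        intro φ u v w; rw [← lie_skew v w, lie_neg, map_neg]
      have e3 := e2 ξ w z y
      have e4 := e2 ζ x z y
      have e5 := e2 η x z w
      grind

instance : LieAlgebra 𝕜 B.Double where
  lie_smul c a b := by
    apply Double.ext <;> intro z <;> simp <;> ring

end LieBialgebra

/-- The direct product Lie bracket on a power of a Lie algebra. -/
instance piLieRing {ι q : Type*} [LieRing q] : LieRing (ι → q) where
  bracket a b := fun i => ⁅a i, b i⁆
  add_lie := by intros; funext i; simp
  lie_add := by intros; funext i; simp
  lie_self := by intros; funext i; simp
  leibniz_lie := by intros; funext i; simp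

@[simp] lemma pi_bracket_apply {ι q : Type*} [LieRing q] (a b : ι → q) (i : ι) :
    ⁅a, b⁆ i = ⁅a i, b i⁆ := rfl

instance piLieAlgebra {ι q : Type*} [LieRing q] [LieAlgebra 𝕜 q] : LieAlgebra 𝕜 (ι → q) where
  lie_smul := by intros; funext i; simp

/-- A Manin triple: a quadratic Lie algebra `q`, i.e. a Lie algebra with a non-degenerate
symmetric ad-invariant bilinear form, with a splitting `q = l + l'` into two Lagrangian
subalgebras.  (Complementary isotropic subspaces are automatically maximal isotropic.) -/
structure ManinTriple (𝕜 q : Type*) [Field 𝕜] [LieRing q] [LieAlgebra 𝕜 q] where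
  form : LinearMap.BilinForm 𝕜 q
  symm : ∀ a b, form a b = form b a
  nondegenerate : ∀ a, (∀ b, form a b = 0) → a = 0
  invariant : ∀ a b c, form ⁅a, b⁆ c = form a ⁅b, c⁆
  l : LieSubalgebra 𝕜 q
  l' : LieSubalgebra 𝕜 q
  isotropic : ∀ a ∈ l, ∀ b ∈ l, form a b = 0
  isotropic' : ∀ a ∈ l', ∀ b ∈ l', form a b = 0
  isCompl : IsCompl l.toSubmodule l'.toSubmodule

namespace ManinTriple

variable {q : Type*} [LieRing q] [LieAlgebra 𝕜 q] (M : ManinTriple 𝕜 q)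

/-- The pairing of `l'` with `l`. -/
def pairing : M.l' →ₗ[𝕜] Dual 𝕜 M.l :=
  M.form.compl₁₂ M.l'.toSubmodule.subtype M.l.toSubmodule.subtype

lemma pairing_apply (ξ : M.l') (x : M.l) : M.pairing ξ x = M.form ξ x := rfl

lemma exists_add (a : q) : ∃ x ∈ M.l, ∃ ξ ∈ M.l', x + ξ = a := by
  have h : a ∈ M.l.toSubmodule ⊔ M.l'.toSubmodule := by
    rw [M.isCompl.sup_eq_top]; trivial
  exact Submodule.mem_sup.1 h

lemma pairing_injective : Function.Injective M.pairing := by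
  rw [← LinearMap.ker_eq_bot, LinearMap.ker_eq_bot']
  intro ξ h
  apply Subtype.ext
  apply M.nondegenerate
  intro b
  obtain ⟨x, hx, η, hη, rfl⟩ := M.exists_add b
  rw [map_add, M.isotropic' _ ξ.2 _ hη, add_zero]
  exact LinearMap.congr_fun h ⟨x, hx⟩

variable [FiniteDimensional 𝕜 q]

lemma pairing_surjective : Function.Surjective M.pairing := by
  intro φ
  have hinj : Function.Injective M.form := by
    rw [← LinearMap.ker_eq_bot, LinearMap.ker_eq_bot']
    intro a h
    exact M.nondegenerate a (fun b => LinearMap.congr_fun h b)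
  have hsurj : Function.Surjective M.form :=
    (LinearMap.injective_iff_surjective_of_finrank_eq_finrank
      (Subspace.dual_finrank_eq (K := 𝕜) (V := q)).symm).1 hinj
  obtain ⟨a, ha⟩ := hsurj (φ ∘ₗ Submodule.projectionOnto _ _ M.isCompl)
  obtain ⟨x, hx, η, hη, rfl⟩ := M.exists_add a
  refine ⟨⟨η, hη⟩, ?_⟩
  ext y
  have := LinearMap.congr_fun ha y
  rw [map_add, LinearMap.add_apply, M.isotropic _ hx _ y.2, zero_add] at this
  rw [pairing_apply]
  change M.form η y = φ y
  rw [this, LinearMap.comp_apply]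
  congr 1
  exact Submodule.projectionOnto_apply_left M.isCompl y

/-- The identification of `l'` with the dual space of `l` through the form. -/
def dualEquiv : M.l' ≃ₗ[𝕜] Dual 𝕜 M.l :=
  LinearEquiv.ofBijective M.pairing ⟨M.pairing_injective, M.pairing_surjective⟩

@[simp] lemma dualEquiv_apply (ξ : M.l') (x : M.l) : M.dualEquiv ξ x = M.form ξ x := rfl

/-- The co-bracket of `l`: the dual map of the Lie bracket of `l' ≅ l*`, that is,
`δ(x)(ξ, η) = ⟨x, [ξ, η]⟩` for `ξ, η ∈ l' ≅ l*`. -/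
def cobracket : M.l →ₗ[𝕜] Tensor2 𝕜 M.l where
  toFun x := LinearMap.mk₂ 𝕜
    (fun ξ η => M.form x (⁅M.dualEquiv.symm ξ, M.dualEquiv.symm η⁆ : M.l'))
    (by intros; simp) (by intros; simp) (by intros; simp) (by intros; simp)
  map_add' := by intros; ext; simp
  map_smul' := by intros; ext; simp

lemma cobracket_apply (x : M.l) (ξ η : M.l') :
    M.cobracket x (M.dualEquiv ξ) (M.dualEquiv η) = M.form x ⁅(ξ : q), (η : q)⁆ := by
  simp [cobracket]

/-- The Lie bialgebra structure on `l` defined by the Lagrangian splitting `q = l + l'`. -/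
def toLieBialgebra : LieBialgebra 𝕜 M.l where
  cobracket := M.cobracket
  cobracket_self := by intros; simp [cobracket]
  dual_jacobi := by
    intro ξ η ζ
    obtain ⟨ξ, rfl⟩ := M.dualEquiv.surjective ξ
    obtain ⟨η, rfl⟩ := M.dualEquiv.surjective η
    obtain ⟨ζ, rfl⟩ := M.dualEquiv.surjective ζ
    have key : ∀ a b, dualBracket M.cobracket (M.dualEquiv a) (M.dualEquiv b) =
        M.dualEquiv ⁅a, b⁆ := by
      intro a b; ext x; simp [cobracket_apply, M.symm]
    rw [key, key, key, key, key, key, ← map_add, ← map_add, lie_jacobi, map_zero]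
  cocycle := by
    intro x y
    ext ξ η
    obtain ⟨ξ, rfl⟩ := M.dualEquiv.surjective ξ
    obtain ⟨η, rfl⟩ := M.dualEquiv.surjective η
    have key : ∀ (x : M.l) (ξ : M.l'), ∃ (u : M.l) (ξ' : M.l'),
        (u : q) + ξ' = ⁅(ξ : q), (x : q)⁆ ∧
        M.dualEquiv ξ ∘ₗ LieAlgebra.ad 𝕜 M.l x = M.dualEquiv ξ' := by
      intro x ξ
      obtain ⟨u, hu, v, hv, h⟩ := M.exists_add ⁅(ξ : q), (x : q)⁆
      refine ⟨⟨u, hu⟩, ⟨v, hv⟩, h, ?_⟩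
      ext y
      have h1 := M.invariant ξ x y
      rw [← h, map_add, LinearMap.add_apply, M.isotropic _ hu _ y.2, zero_add] at h1
      simp [h1]
    obtain ⟨a, ξx, ha, hξx⟩ := key x ξ
    obtain ⟨b, ηx, hb, hηx⟩ := key x η
    obtain ⟨c, ξy, hc, hξy⟩ := key y ξ
    obtain ⟨d, ηy, hd, hηy⟩ := key y η
    simp only [LinearMap.sub_apply, adTensor_apply, hξx, hηx, hξy, hηy, cobracket_apply]
    have F1 : M.form y ⁅(a : q), (η : q)⁆ = M.form a ηy := by
      rw [M.symm, M.invariant, ← hd, map_add, M.isotropic _ a.2 _ d.2, zero_add]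
    have F2 : M.form x ⁅(ξ : q), (ηy : q)⁆ = -M.form a ηy := by
      rw [← M.invariant, ← lie_skew, map_neg, ← ha, LinearMap.neg_apply, map_add,
        LinearMap.add_apply, M.isotropic' _ ξx.2 _ ηy.2, add_zero]
    have F3 : M.form x ⁅(c : q), (η : q)⁆ = M.form c ηx := by
      rw [M.symm, M.invariant, ← hb, map_add, M.isotropic _ c.2 _ b.2, zero_add]
    have F4 : M.form y ⁅(ξ : q), (ηx : q)⁆ = -M.form c ηx := by
      rw [← M.invariant, ← lie_skew, map_neg, ← hc, LinearMap.neg_apply, map_add,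
        LinearMap.add_apply, M.isotropic' _ ξy.2 _ ηx.2, add_zero]
    have F5 : M.form y ⁅⁅(ξ : q), (x : q)⁆, (η : q)⁆ = M.form ξ ⁅(x : q), ⁅(η : q), (y : q)⁆⁆ := by
      rw [M.symm, M.invariant, M.invariant]
    have F6 : M.form x ⁅⁅(ξ : q), (y : q)⁆, (η : q)⁆ = M.form ξ ⁅(y : q), ⁅(η : q), (x : q)⁆⁆ := by
      rw [M.symm, M.invariant, M.invariant]
    have F7 : M.form (⁅x, y⁆ : M.l) ⁅(ξ : q), (η : q)⁆ =
        M.form ξ ⁅(x : q), ⁅(η : q), (y : q)⁆⁆ - M.form ξ ⁅(y : q), ⁅(η : q), (x : q)⁆⁆ := by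
      rw [M.symm, M.invariant, ← map_sub, LieSubalgebra.coe_bracket, leibniz_lie,
        ← lie_skew ⁅(η : q), (x : q)⁆ (y : q)]
      congr 1
      abel
    rw [← ha, add_lie, map_add] at F5
    rw [← hc, add_lie, map_add] at F6
    rw [F7, F2, F4]
    linear_combination F6 - F5 + F1 - F3

/-- The Manin triple `(q ⊕ q, q_diag, l' ⊕ l)`, with the form `⟨a₁, b₁⟩ - ⟨a₂, b₂⟩`. -/
def double : ManinTriple 𝕜 (q × q) where
  form := M.form.compl₁₂ (LinearMap.fst 𝕜 q q) (LinearMap.fst 𝕜 q q) -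
    M.form.compl₁₂ (LinearMap.snd 𝕜 q q) (LinearMap.snd 𝕜 q q)
  symm := by
    intro a b
    simp [M.symm a.1, M.symm a.2]
  nondegenerate := by
    intro a h
    apply Prod.ext
    · apply M.nondegenerate
      intro b
      simpa using h (b, 0)
    · apply M.nondegenerate
      intro b
      simpa using h (0, b)
  invariant := by
    intro a b c
    simp [M.invariant]
  l :=
    { carrier := {a | a.1 = a.2}
      add_mem' := by intro a b ha hb; simp_all
      zero_mem' := by simp
      smul_mem' := by intro c a ha; simp_all
      lie_mem' := by intro a b ha hb; simp_all }
  l' :=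
    { carrier := {a | a.1 ∈ M.l' ∧ a.2 ∈ M.l}
      add_mem' := by
        intro a b ha hb
        exact ⟨add_mem ha.1 hb.1, add_mem ha.2 hb.2⟩
      zero_mem' := ⟨zero_mem _, zero_mem _⟩
      smul_mem' := by
        intro c a ha
        exact ⟨M.l'.smul_mem c ha.1, M.l.smul_mem c ha.2⟩
      lie_mem' := by
        intro a b ha hb
        exact ⟨M.l'.lie_mem ha.1 hb.1, M.l.lie_mem ha.2 hb.2⟩ }
  isotropic := by
    intro a ha b hb
    change a.1 = a.2 at ha
    change b.1 = b.2 at hb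
    simp [ha, hb]
  isotropic' := by
    intro a ha b hb
    change a.1 ∈ M.l' ∧ a.2 ∈ M.l at ha
    change b.1 ∈ M.l' ∧ b.2 ∈ M.l at hb
    simp [M.isotropic _ ha.2 _ hb.2, M.isotropic' _ ha.1 _ hb.1]
  isCompl := by
    constructor
    · rw [Submodule.disjoint_def]
      intro a ha hb
      change a.1 = a.2 at ha
      change a.1 ∈ M.l' ∧ a.2 ∈ M.l at hb
      have h : a.2 = 0 :=
        (Submodule.disjoint_def.1 M.isCompl.disjoint) _ hb.2 (ha ▸ hb.1)
      exact Prod.ext (ha.trans h) h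
    · rw [codisjoint_iff, eq_top_iff]
      intro a _
      obtain ⟨x, hx, ξ, hξ, h⟩ := M.exists_add (a.1 - a.2)
      refine Submodule.mem_sup.2 ⟨(a.2 + x, a.2 + x), ?_, (ξ, -x), ?_, ?_⟩
      · rfl
      · exact ⟨hξ, neg_mem hx⟩
      · apply Prod.ext
        · simp only [Prod.fst_add]
          rw [add_assoc, h]; abel
        · simp

/-- The identification `q_diag ≅ q`, `(a, a) ↦ a`. -/
def diagEquiv : M.double.l ≃ₗ⁅𝕜⁆ q where
  toFun a := (a : q × q).1
  map_add' := by intros; rfl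
  map_smul' := by intros; rfl
  map_lie' := by intros; rfl
  invFun a := ⟨(a, a), rfl⟩
  left_inv := by
    rintro ⟨⟨a, b⟩, h⟩
    apply Subtype.ext
    change a = b at h
    simp [h]
  right_inv := by intro a; rfl

/-- The double Lie bialgebra structure on `q`, for a Lagrangian splitting `q = l + l'`: the Lie
bialgebra structure defined on `q ≅ q_diag` by the Lagrangian splitting
`q ⊕ q = q_diag + (l' ⊕ l)`. -/
def doubleBialgebra : LieBialgebra 𝕜 q := M.double.toLieBialgebra.congr M.diagEquiv

end ManinTriple

section Polyuble

lemma alternating_sum_even (f : ℕ → 𝕜) (h : ∀ k, f (2 * k) = f (2 * k + 1)) (m : ℕ) :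
    ∑ i ∈ Finset.range (2 * m), (-1) ^ i * f i = 0 := by
  induction m with
  | zero => simp
  | succ m ih =>
    rw [show 2 * (m + 1) = 2 * m + 1 + 1 by ring, Finset.sum_range_succ, Finset.sum_range_succ, ih,
      ← h m, pow_succ, pow_mul]
    simp

lemma alternating_sum_odd (f : ℕ → 𝕜) (h0 : f 0 = 0)
    (h : ∀ k, f (2 * k + 1) = f (2 * k + 2)) (m : ℕ) :
    ∑ i ∈ Finset.range (2 * m + 1), (-1) ^ i * f i = 0 := by
  induction m with
  | zero => simp [h0]
  | succ m ih =>
    rw [show 2 * (m + 1) + 1 = 2 * m + 1 + 1 + 1 by ring, Finset.sum_range_succ,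
      Finset.sum_range_succ, ih, show 2 * m + 1 + 1 = 2 * m + 2 by ring, ← h m, pow_succ,
      pow_add, pow_mul]
    simp

lemma alternating_sum_fin {n : ℕ} (f : ℕ → 𝕜) (hf : ∀ i, n ≤ i → f i = 0) (N : ℕ) (hN : n ≤ N) :
    ∑ i : Fin n, (-1) ^ (i : ℕ) * f i = ∑ i ∈ Finset.range N, (-1) ^ i * f i := by
  rw [Fin.sum_univ_eq_sum_range (fun i => (-1) ^ i * f i) n]
  apply Finset.sum_subset (Finset.range_mono hN)
  intro i _ hi
  rw [hf i (by simpa using hi), mul_zero]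

variable {q : Type*} [LieRing q] [LieAlgebra 𝕜 q] (M : ManinTriple 𝕜 q)

/-- The form `∑_{j = 1}^{n} (-1)^{j + 1} ⟨a_j, b_j⟩` on `q^n`; the indices in the code start
at `0`. -/
def polyubleForm (n : ℕ) : LinearMap.BilinForm 𝕜 (Fin n → q) :=
  ∑ i : Fin n, (-1 : 𝕜) ^ (i : ℕ) •
    M.form.compl₁₂ (LinearMap.proj i : (Fin n → q) →ₗ[𝕜] q) (LinearMap.proj i)

lemma polyubleForm_apply (n : ℕ) (a b : Fin n → q) :
    polyubleForm M n a b = ∑ i : Fin n, (-1) ^ (i : ℕ) * M.form (a i) (b i) := by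
  simp [polyubleForm, LinearMap.sum_apply]

/-- The subalgebra of `q^n` which is `q_diag ⊕ ⋯ ⊕ q_diag` for even `n`, and
`q_diag ⊕ ⋯ ⊕ q_diag ⊕ l` for odd `n`. -/
def polyublePlus (n : ℕ) : LieSubalgebra 𝕜 (Fin n → q) where
  carrier := {a | ∀ i : Fin n, Even (i : ℕ) →
    (∀ h : (i : ℕ) + 1 < n, a i = a ⟨i + 1, h⟩) ∧ ((i : ℕ) + 1 = n → a i ∈ M.l)}
  add_mem' := by
    intro a b ha hb i hi
    refine ⟨fun h => ?_, fun h => add_mem ((ha i hi).2 h) ((hb i hi).2 h)⟩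
    simp [(ha i hi).1 h, (hb i hi).1 h]
  zero_mem' := fun i _ => ⟨fun _ => rfl, fun _ => zero_mem _⟩
  smul_mem' := by
    intro c a ha i hi
    refine ⟨fun h => ?_, fun h => M.l.smul_mem c ((ha i hi).2 h)⟩
    simp [(ha i hi).1 h]
  lie_mem' := by
    intro a b ha hb i hi
    refine ⟨fun h => ?_, fun h => M.l.lie_mem ((ha i hi).2 h) ((hb i hi).2 h)⟩
    simp [(ha i hi).1 h, (hb i hi).1 h]

/-- The subalgebra of `q^n` which is `l' ⊕ q_diag ⊕ ⋯ ⊕ q_diag ⊕ l` for even `n`, and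
`l' ⊕ q_diag ⊕ ⋯ ⊕ q_diag` for odd `n`. -/
def polyubleMinus (n : ℕ) : LieSubalgebra 𝕜 (Fin n → q) where
  carrier := {a | (∀ i : Fin n, (i : ℕ) = 0 → a i ∈ M.l') ∧ ∀ i : Fin n, Odd (i : ℕ) →
    (∀ h : (i : ℕ) + 1 < n, a i = a ⟨i + 1, h⟩) ∧ ((i : ℕ) + 1 = n → a i ∈ M.l)}
  add_mem' := by
    rintro a b ⟨ha0, ha⟩ ⟨hb0, hb⟩
    refine ⟨fun i hi => add_mem (ha0 i hi) (hb0 i hi), fun i hi =>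
      ⟨fun h => ?_, fun h => add_mem ((ha i hi).2 h) ((hb i hi).2 h)⟩⟩
    simp [(ha i hi).1 h, (hb i hi).1 h]
  zero_mem' := ⟨fun _ _ => zero_mem _, fun i _ => ⟨fun _ => rfl, fun _ => zero_mem _⟩⟩
  smul_mem' := by
    rintro c a ⟨ha0, ha⟩
    refine ⟨fun i hi => M.l'.smul_mem c (ha0 i hi), fun i hi =>
      ⟨fun h => ?_, fun h => M.l.smul_mem c ((ha i hi).2 h)⟩⟩
    simp [(ha i hi).1 h]
  lie_mem' := by
    rintro a b ⟨ha0, ha⟩ ⟨hb0, hb⟩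
    refine ⟨fun i hi => M.l'.lie_mem (ha0 i hi) (hb0 i hi), fun i hi =>
      ⟨fun h => ?_, fun h => M.l.lie_mem ((ha i hi).2 h) ((hb i hi).2 h)⟩⟩
    simp [(ha i hi).1 h, (hb i hi).1 h]

lemma polyuble_disjoint (n : ℕ) :
    Disjoint (polyublePlus M n).toSubmodule (polyubleMinus M n).toSubmodule := by
  rw [Submodule.disjoint_def]
  rintro a ha ⟨hb0, hb⟩
  change ∀ i : Fin n, _ at ha
  have hstep : ∀ (i : ℕ) (h : i + 1 < n), a ⟨i, by omega⟩ = a ⟨i + 1, h⟩ := by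
    intro i h
    rcases Nat.even_or_odd i with hi | hi
    · exact (ha ⟨i, by omega⟩ hi).1 h
    · exact (hb ⟨i, by omega⟩ hi).1 h
  have hall : ∀ (i : ℕ) (h : i < n), a ⟨i, h⟩ = a ⟨0, by omega⟩ := by
    intro i
    induction i with
    | zero => intro h; rfl
    | succ i ih => intro h; rw [← hstep i h]; exact ih _
  funext i
  have hn : 0 < n := i.pos
  have hlast : a ⟨n - 1, by omega⟩ ∈ M.l := by
    rcases Nat.even_or_odd (n - 1) with hi | hi
    · exact (ha ⟨n - 1, by omega⟩ hi).2 (by simp; omega)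
    · exact (hb ⟨n - 1, by omega⟩ hi).2 (by simp; omega)
  rw [hall] at hlast
  have h0 := (Submodule.disjoint_def.1 M.isCompl.disjoint) _ hlast (hb0 ⟨0, hn⟩ rfl)
  exact (hall i i.2).trans h0

lemma polyuble_codisjoint (n : ℕ) :
    Codisjoint (polyublePlus M n).toSubmodule (polyubleMinus M n).toSubmodule := by
  rw [codisjoint_iff, eq_top_iff]
  intro c _
  rcases Nat.eq_zero_or_pos n with rfl | hn
  · have : c = 0 := Subsingleton.elim _ _
    rw [this]; exact zero_mem _
  let C : ℕ → q := fun i => if h : i < n then c ⟨i, h⟩ else 0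
  have hC : ∀ i : Fin n, c i = C i := fun i => by simp [C]
  let D : ℕ → q := fun i => ∑ k ∈ Finset.range i, if Odd k then C k - C (k + 1) else 0
  have hDe : ∀ i, Even i → D (i + 1) = D i := by
    intro i hi
    have : ¬ Odd i := by simpa using hi
    simp [D, Finset.sum_range_succ, this]
  have hDo : ∀ i, Odd i → D (i + 1) = D i + (C i - C (i + 1)) := by
    intro i hi
    simp [D, Finset.sum_range_succ, hi]
  obtain ⟨x, hx, ξ, hξ, h⟩ := M.exists_add
    (C 0 - (D (n - 1) + if Even (n - 1) then 0 else C (n - 1)))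
  obtain ⟨u, hu⟩ : ∃ u, u = C 0 - ξ := ⟨_, rfl⟩
  have hu2 : u = D (n - 1) + (if Even (n - 1) then 0 else C (n - 1)) + x := by
    rw [hu, sub_eq_iff_eq_add, add_assoc, h]; abel
  refine Submodule.mem_sup.2 ⟨fun i => u - D i, ?_, fun i => c i - (u - D i), ⟨?_, ?_⟩, ?_⟩
  · intro i hi
    refine ⟨fun h => ?_, fun h => ?_⟩
    · simp [hDe i hi]
    · have hin : (i : ℕ) = n - 1 := by omega
      simp only [hin] at hi ⊢
      rw [hu2, if_pos hi]
      simpa using hx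
  · intro i hi
    simp only [hC, hi, hu]
    simpa [D] using hξ
  · intro i hi
    refine ⟨fun h => ?_, fun h => ?_⟩
    · simp only [hC, hDo i hi]
      abel
    · have hin : (i : ℕ) = n - 1 := by omega
      simp only [hC, hin] at hi ⊢
      rw [hu2, if_neg (by simpa using hi)]
      have : C (n - 1) - (D (n - 1) + C (n - 1) + x - D (n - 1)) = -x := by abel
      rw [this]
      exact neg_mem hx
  · funext i
    simp

/-- The Manin triple `(q^n, polyublePlus, polyubleMinus)` attached to a Manin triple
`(q, l, l')`; for the Manin triple of a Lie bialgebra, `polyublePlus` is its `n`-uble. -/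
def polyubleTriple (n : ℕ) : ManinTriple 𝕜 (Fin n → q) where
  form := polyubleForm M n
  symm := by
    intro a b
    simp only [polyubleForm_apply]
    exact Finset.sum_congr rfl fun i _ => by rw [M.symm]
  nondegenerate := by
    intro a h
    funext i
    apply M.nondegenerate
    intro b
    have := h (Pi.single i b)
    rw [polyubleForm_apply, Finset.sum_eq_single i] at this
    · simpa using this
    · intro j _ hj
      simp [Pi.single_eq_of_ne hj]
    · simp
  invariant := by
    intro a b c
    simp [polyubleForm_apply, M.invariant]
  l := polyublePlus M n
  l' := polyubleMinus M n
  isotropic := by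
    intro a ha b hb
    change ∀ i : Fin n, _ at ha
    change ∀ i : Fin n, _ at hb
    let f : ℕ → 𝕜 := fun i => if h : i < n then M.form (a ⟨i, h⟩) (b ⟨i, h⟩) else 0
    have hf : ∀ i : Fin n, M.form (a i) (b i) = f i := fun i => by simp [f]
    simp only [polyubleForm_apply, hf]
    rw [alternating_sum_fin f (fun i hi => by simp [f, hi]) (2 * n) (by omega)]
    apply alternating_sum_even
    intro k
    have hk : Even (2 * k) := even_two_mul k
    by_cases h1 : 2 * k + 1 < n
    · have h2 : 2 * k < n := by omega
      simp only [f, h1, h2, dif_pos]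
      rw [(ha ⟨2 * k, h2⟩ hk).1 h1, (hb ⟨2 * k, h2⟩ hk).1 h1]
    · by_cases h2 : 2 * k < n
      · simp only [f, h1, h2, dif_pos, dif_neg, not_false_eq_true]
        exact M.isotropic _ ((ha ⟨2 * k, h2⟩ hk).2 (by simp; omega)) _
          ((hb ⟨2 * k, h2⟩ hk).2 (by simp; omega))
      · simp [f, h1, h2]
  isotropic' := by
    rintro a ⟨ha0, ha⟩ b ⟨hb0, hb⟩
    let f : ℕ → 𝕜 := fun i => if h : i < n then M.form (a ⟨i, h⟩) (b ⟨i, h⟩) else 0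
    have hf : ∀ i : Fin n, M.form (a i) (b i) = f i := fun i => by simp [f]
    simp only [polyubleForm_apply, hf]
    rw [alternating_sum_fin f (fun i hi => by simp [f, hi]) (2 * n + 1) (by omega)]
    apply alternating_sum_odd
    · by_cases h : 0 < n
      · simp only [f, h, dif_pos]
        exact M.isotropic' _ (ha0 ⟨0, h⟩ rfl) _ (hb0 ⟨0, h⟩ rfl)
      · simp [f, h]
    · intro k
      have hk : Odd (2 * k + 1) := odd_two_mul_add_one k
      by_cases h1 : 2 * k + 1 + 1 < n
      · have h2 : 2 * k + 1 < n := by omega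
        simp only [f, h1, h2, dif_pos, show 2 * k + 2 = 2 * k + 1 + 1 from rfl]
        rw [(ha ⟨2 * k + 1, h2⟩ hk).1 h1, (hb ⟨2 * k + 1, h2⟩ hk).1 h1]
      · have h1' : ¬ 2 * k + 2 < n := h1
        by_cases h2 : 2 * k + 1 < n
        · simp only [f, h1', h2, dif_pos, dif_neg, not_false_eq_true]
          exact M.isotropic _ ((ha ⟨2 * k + 1, h2⟩ hk).2 (by simp; omega)) _
            ((hb ⟨2 * k + 1, h2⟩ hk).2 (by simp; omega))
        · simp [f, h1', h2]
  isCompl := ⟨polyuble_disjoint M n, polyuble_codisjoint M n⟩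

end Polyuble

namespace LieBialgebra

variable {g : Type*} [LieRing g] [LieAlgebra 𝕜 g]

/-- The inclusion `g → d` into the double. -/
def inl (B : LieBialgebra 𝕜 g) : g →ₗ[𝕜] B.Double := LinearMap.inl 𝕜 g B.DualLie

/-- The inclusion `g* → d` into the double. -/
def inr (B : LieBialgebra 𝕜 g) : B.DualLie →ₗ[𝕜] B.Double := LinearMap.inr 𝕜 g B.DualLie

/-- The form `⟨x + ξ, y + η⟩ = ⟨x, η⟩ + ⟨ξ, y⟩` on the double. -/
def doubleForm (B : LieBialgebra 𝕜 g) : LinearMap.BilinForm 𝕜 B.Double :=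
  LinearMap.mk₂ 𝕜 (fun a b => B.toDualLie.symm b.2 a.1 + B.toDualLie.symm a.2 b.1)
    (by intros; simp; ring) (by intros; simp; ring) (by intros; simp; ring)
    (by intros; simp; ring)

lemma doubleForm_apply (B : LieBialgebra 𝕜 g) (a b : B.Double) :
    B.doubleForm a b = B.toDualLie.symm b.2 a.1 + B.toDualLie.symm a.2 b.1 := rfl

variable [FiniteDimensional 𝕜 g]

/-- The Manin triple `(d, g, g*)` given by the double Lie algebra `d = g ⊕ g*`. -/
def maninTriple (B : LieBialgebra 𝕜 g) : ManinTriple 𝕜 B.Double where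
  form := B.doubleForm
  symm := by
    intro a b
    simp only [doubleForm_apply]; ring
  nondegenerate := by
    intro a h
    apply Double.ext
    · intro ξ
      have h1 : ξ a.1 + B.toDualLie.symm a.2 0 = 0 := h (B.inr (B.toDualLie ξ))
      simpa using h1
    · intro x
      have h1 : (0 : Dual 𝕜 g) a.1 + B.toDualLie.symm a.2 x = 0 := h (B.inl x)
      simpa using h1
  invariant := by
    intro a b c
    simp only [doubleForm_apply, Double.apply_fst_bracket, Double.snd_bracket_apply]
    rw [← lie_skew b.1 c.1, ← lie_skew a.1 c.1, map_neg, map_neg,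
      B.cobracket_swap a.1 _ (B.toDualLie.symm b.2), B.cobracket_swap b.1 _ (B.toDualLie.symm a.2)]
    ring
  l :=
    { carrier := {a | a.2 = 0}
      add_mem' := by
        intro a b ha hb
        change a.2 + b.2 = 0
        rw [show a.2 = 0 from ha, show b.2 = 0 from hb, add_zero]
      zero_mem' := rfl
      smul_mem' := by
        intro c a ha
        change c • a.2 = 0
        rw [show a.2 = 0 from ha, smul_zero]
      lie_mem' := by
        intro a b ha hb
        apply B.toDualLie.symm.injective
        ext z
        simp [show a.2 = 0 from ha, show b.2 = 0 from hb] }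
  l' :=
    { carrier := {a | a.1 = 0}
      add_mem' := by
        intro a b ha hb
        change a.1 + b.1 = 0
        rw [show a.1 = 0 from ha, show b.1 = 0 from hb, add_zero]
      zero_mem' := rfl
      smul_mem' := by
        intro c a ha
        change c • a.1 = 0
        rw [show a.1 = 0 from ha, smul_zero]
      lie_mem' := by
        intro a b ha hb
        apply eq_of_forall_dual (𝕜 := 𝕜)
        intro z
        simp [show a.1 = 0 from ha, show b.1 = 0 from hb] }
  isotropic := by
    intro a ha b hb
    simp [doubleForm_apply, show a.2 = 0 from ha, show b.2 = 0 from hb]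
  isotropic' := by
    intro a ha b hb
    simp [doubleForm_apply, show a.1 = 0 from ha, show b.1 = 0 from hb]
  isCompl := by
    constructor
    · rw [Submodule.disjoint_def]
      intro a ha hb
      exact Prod.ext hb ha
    · rw [codisjoint_iff, eq_top_iff]
      intro a _
      refine Submodule.mem_sup.2 ⟨(a.1, 0), rfl, (0, a.2), rfl, ?_⟩
      exact Prod.ext (add_zero _) (zero_add _)

/-- The Drinfeld double Lie bialgebra `(d, δ_d)` of a Lie bialgebra `g`. -/
def doubleBialgebra (B : LieBialgebra 𝕜 g) : LieBialgebra 𝕜 B.Double :=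
  B.maninTriple.doubleBialgebra

/-- The Lie bialgebra `(d^n, δ_{d^n})`: the double Lie bialgebra of the `n`-uble of `g`, i.e. of
the Lagrangian splitting `d^n = g_(n) + g*_(n)`. -/
def polyubleDouble (B : LieBialgebra 𝕜 g) (n : ℕ) : LieBialgebra 𝕜 (Fin n → B.Double) :=
  (polyubleTriple B.maninTriple n).doubleBialgebra

end LieBialgebra

end Algebra
section Manifold

open scoped Manifold ContDiff

variable {𝕜 : Type*} [RCLike 𝕜]

section Flat

variable {E : Type*} [NormedAddCommGroup E] [NormedSpace 𝕜 E]

/-- The Schouten bracket `[X, P]` (the Lie derivative of `P` along `X`) of a vector field `X` and a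
bivector field `P` on the vector space `E`, evaluated at `e` on two covectors `α, β` (extended as
constant one-forms, i.e. as the differentials of the linear functions `α` and `β`):
`X (P(α, β)) - P(d(α(X)), β) - P(α, d(β(X)))`. -/
def flatLieDeriv (X : E → E) (P : E → Tensor2 𝕜 E) (e : E) (α β : Dual 𝕜 E) : 𝕜 :=
  fderiv 𝕜 (fun z => P z α β) e (X e) -
    P e (α ∘ₗ (fderiv 𝕜 X e).toLinearMap) β - P e α (β ∘ₗ (fderiv 𝕜 X e).toLinearMap)

/-- The Schouten bracket `[P, Q]` of two bivector fields on the vector space `E`, evaluated at `e`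
on three covectors (extended as constant one-forms): the sum over the cyclic permutations of
`(α, β, γ)` of `P(α, d(Q(β, γ))) + Q(α, d(P(β, γ)))`. -/
def flatSchouten (P Q : E → Tensor2 𝕜 E) (e : E) (α β γ : Dual 𝕜 E) : 𝕜 :=
  P e α (fderiv 𝕜 (fun z => Q z β γ) e).toLinearMap +
    P e β (fderiv 𝕜 (fun z => Q z γ α) e).toLinearMap +
    P e γ (fderiv 𝕜 (fun z => Q z α β) e).toLinearMap +
    (Q e α (fderiv 𝕜 (fun z => P z β γ) e).toLinearMap +
    Q e β (fderiv 𝕜 (fun z => P z γ α) e).toLinearMap +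
    Q e γ (fderiv 𝕜 (fun z => P z α β) e).toLinearMap)

end Flat

section Fields

variable {E : Type*} [NormedAddCommGroup E] [NormedSpace 𝕜 E] {H : Type*} [TopologicalSpace H]
  (I : ModelWithCorners 𝕜 E H) {Y : Type*} [TopologicalSpace Y] [ChartedSpace H Y]

/-- The expression of a vector field in the chart at `y₀`. -/
def chartVectorField (X : ∀ y : Y, TangentSpace I y) (y₀ : Y) (e : E) : E :=
  mfderiv I 𝓘(𝕜, E) (extChartAt I y₀) ((extChartAt I y₀).symm e) (X ((extChartAt I y₀).symm e))

/-- The expression of a field of contravariant two-tensors in the chart at `y₀`. -/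
def chartTensorField (P : ∀ y : Y, Tensor2 𝕜 (TangentSpace I y)) (y₀ : Y) (e : E) : Tensor2 𝕜 E :=
  Tensor2.map (mfderiv I 𝓘(𝕜, E) (extChartAt I y₀) ((extChartAt I y₀).symm e)).toLinearMap
    (P ((extChartAt I y₀).symm e))

/-- The expression of a covector at `y` in the chart at `y`. -/
def chartCovector (y : Y) (α : Dual 𝕜 (TangentSpace I y)) : Dual 𝕜 E :=
  α ∘ₗ ((mfderiv I 𝓘(𝕜, E) (extChartAt I y) y).inverse).toLinearMap

/-- The Schouten bracket `[X, P]` of a vector field and a bivector field on a manifold without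
boundary, at the point `y`, computed in the chart at `y`. -/
def lieDeriv (X : ∀ y : Y, TangentSpace I y) (P : ∀ y : Y, Tensor2 𝕜 (TangentSpace I y)) (y : Y)
    (α β : Dual 𝕜 (TangentSpace I y)) : 𝕜 :=
  flatLieDeriv (chartVectorField I X y) (chartTensorField I P y) (extChartAt I y y)
    (chartCovector I y α) (chartCovector I y β)

/-- The Schouten bracket `[P, Q]` of two bivector fields on a manifold without boundary, at the
point `y`, computed in the chart at `y`. -/
def schouten (P Q : ∀ y : Y, Tensor2 𝕜 (TangentSpace I y)) (y : Y)
    (α β γ : Dual 𝕜 (TangentSpace I y)) : 𝕜 :=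
  flatSchouten (chartTensorField I P y) (chartTensorField I Q y) (extChartAt I y y)
    (chartCovector I y α) (chartCovector I y β) (chartCovector I y γ)

/-- `π` is a Poisson structure: a smooth (holomorphic if `𝕜 = ℂ`) bivector field with
`[π, π] = 0`.  Smoothness means that the components in charts are smooth. -/
structure IsPoisson (π : ∀ y : Y, Tensor2 𝕜 (TangentSpace I y)) : Prop where
  alternating : ∀ y α, π y α α = 0
  smooth : ∀ (y₀ : Y) (α β : Dual 𝕜 E),
    ContDiffOn 𝕜 ∞ (fun e => chartTensorField I π y₀ e α β) (extChartAt I y₀).target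
  schouten_self : ∀ y α β γ, schouten I π π y α β γ = 0

variable {g : Type*} [LieRing g] [LieAlgebra 𝕜 g]

/-- `(Y, π, σ)` is a left Poisson space of the Lie bialgebra `(g, δ)`: `π` is a Poisson structure
and `σ` is a Lie algebra anti-homomorphism from `g` to the smooth vector fields on `Y` such that
`[σ(x), π] = σ(δ(x))` for all `x`. -/
structure IsLeftPoissonSpace [IsManifold I ∞ Y] (B : LieBialgebra 𝕜 g)
    (π : ∀ y : Y, Tensor2 𝕜 (TangentSpace I y))
    (σ : g →ₗ[𝕜] ∀ y : Y, TangentSpace I y) : Prop where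
  isPoisson : IsPoisson I π
  smooth : ∀ x : g, ContMDiff I I.tangent ∞ (fun y => (⟨y, σ x y⟩ : TangentBundle I Y))
  map_lie : ∀ (x x' : g) (y : Y), σ ⁅x, x'⁆ y = -VectorField.mlieBracket I (σ x) (σ x') y
  compat : ∀ (x : g) (y : Y) (α β : Dual 𝕜 (TangentSpace I y)),
    lieDeriv I (σ x) π y α β = Tensor2.map (LinearMap.proj y ∘ₗ σ) (B.cobracket x) α β

/-- `(Y, π, ρ)` is a right Poisson space of the Lie bialgebra `(g, δ)`: `π` is a Poisson structure
and `ρ` is a Lie algebra homomorphism from `g` to the smooth vector fields on `Y` such that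
`[ρ(x), π] = ρ(δ(x))` for all `x`. -/
structure IsRightPoissonSpace [IsManifold I ∞ Y] (B : LieBialgebra 𝕜 g)
    (π : ∀ y : Y, Tensor2 𝕜 (TangentSpace I y))
    (ρ : g →ₗ[𝕜] ∀ y : Y, TangentSpace I y) : Prop where
  isPoisson : IsPoisson I π
  smooth : ∀ x : g, ContMDiff I I.tangent ∞ (fun y => (⟨y, ρ x y⟩ : TangentBundle I Y))
  map_lie : ∀ (x x' : g) (y : Y), ρ ⁅x, x'⁆ y = VectorField.mlieBracket I (ρ x) (ρ x') y
  compat : ∀ (x : g) (y : Y) (α β : Dual 𝕜 (TangentSpace I y)),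
    lieDeriv I (ρ x) π y α β = Tensor2.map (LinearMap.proj y ∘ₗ ρ) (B.cobracket x) α β

/-- The restriction `λ = σ|_g` of an action of the double. -/
def restrictLeft (B : LieBialgebra 𝕜 g) (σ : B.Double →ₗ[𝕜] ∀ y : Y, TangentSpace I y) :
    g →ₗ[𝕜] ∀ y : Y, TangentSpace I y := σ ∘ₗ B.inl

/-- The restriction `ρ = -σ|_{g*}` of an action of the double. -/
def restrictRight (B : LieBialgebra 𝕜 g) (σ : B.Double →ₗ[𝕜] ∀ y : Y, TangentSpace I y) :
    B.DualLie →ₗ[𝕜] ∀ y : Y, TangentSpace I y := -(σ ∘ₗ B.inr)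

end Fields

section TwoFold

variable {E₁ : Type*} [NormedAddCommGroup E₁] [NormedSpace 𝕜 E₁] {H₁ : Type*}
  [TopologicalSpace H₁] (I₁ : ModelWithCorners 𝕜 E₁ H₁)
  {X : Type*} [TopologicalSpace X] [ChartedSpace H₁ X]
  {E₂ : Type*} [NormedAddCommGroup E₂] [NormedSpace 𝕜 E₂] {H₂ : Type*}
  [TopologicalSpace H₂] (I₂ : ModelWithCorners 𝕜 E₂ H₂)
  {Y : Type*} [TopologicalSpace Y] [ChartedSpace H₂ Y]

/-- The inclusion `T_x X → T_(x,y) (X × Y)`. -/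
def tangentInl (p : X × Y) : TangentSpace I₁ p.1 →ₗ[𝕜] TangentSpace (I₁.prod I₂) p :=
  LinearMap.inl 𝕜 E₁ E₂

/-- The inclusion `T_y Y → T_(x,y) (X × Y)`. -/
def tangentInr (p : X × Y) : TangentSpace I₂ p.2 →ₗ[𝕜] TangentSpace (I₁.prod I₂) p :=
  LinearMap.inr 𝕜 E₁ E₂

variable {g : Type*} [LieRing g] [LieAlgebra 𝕜 g] {ι : Type*} [Fintype ι]

/-- The two-fold mixed product `π_X ×_(ρ, λ) π_Y = (π_X, π_Y) - ∑ᵢ (ρ(ξᵢ), 0) ∧ (0, λ(xᵢ))` on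
`X × Y`, where `(xᵢ)` is a basis of `g` and `(ξᵢ)` the dual basis of `g*`. -/
def mixedProduct (B : LieBialgebra 𝕜 g) (b : Basis ι 𝕜 g)
    (πX : ∀ x : X, Tensor2 𝕜 (TangentSpace I₁ x)) (πY : ∀ y : Y, Tensor2 𝕜 (TangentSpace I₂ y))
    (ρ : B.DualLie →ₗ[𝕜] ∀ x : X, TangentSpace I₁ x) (lam : g →ₗ[𝕜] ∀ y : Y, TangentSpace I₂ y)
    (p : X × Y) : Tensor2 𝕜 (TangentSpace (I₁.prod I₂) p) :=
  Tensor2.map (tangentInl I₁ I₂ p) (πX p.1) + Tensor2.map (tangentInr I₁ I₂ p) (πY p.2) -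
    ∑ i, wedge 𝕜 (tangentInl I₁ I₂ p (ρ (B.toDualLie (b.coord i)) p.1))
      (tangentInr I₁ I₂ p (lam (b i) p.2))

end TwoFold

section ManyFold

variable {n : ℕ} {E : Fin n → Type*} [∀ j, NormedAddCommGroup (E j)] [∀ j, NormedSpace 𝕜 (E j)]
  {H : Fin n → Type*} [∀ j, TopologicalSpace (H j)] (I : ∀ j, ModelWithCorners 𝕜 (E j) (H j))
  {Y : Fin n → Type*} [∀ j, TopologicalSpace (Y j)] [∀ j, ChartedSpace (H j) (Y j)]

/-- A finite product of `C^m` manifolds is a `C^m` manifold. -/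
instance isManifold_pi {m : WithTop ℕ∞} [∀ j, IsManifold (I j) m (Y j)] :
    IsManifold (ModelWithCorners.pi I) m (∀ j, Y j) := by
  apply isManifold_of_contDiffOn
  rintro _ _ ⟨e, he, rfl⟩ ⟨f, hf, rfl⟩
  rw [contDiffOn_pi]
  intro j
  obtain ⟨h, -⟩ := (contDiffGroupoid m (I j)).compatible (he j trivial) (hf j trivial)
  refine ContDiffOn.comp (g := I j ∘ ((e j).symm ≫ₕ f j) ∘ (I j).symm)
    (f := fun z : ∀ j, E j => z j) h
    (ContinuousLinearMap.proj (R := 𝕜) (φ := E) j).contDiff.contDiffOn ?_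
  rintro z ⟨⟨hz1, hz2⟩, ⟨w, rfl⟩⟩
  exact ⟨⟨hz1 j trivial, hz2 j trivial⟩, ⟨w j, rfl⟩⟩

/-- The inclusion `T_{y_j} Y_j → T_y (Y_1 × ⋯ × Y_n)`. -/
def tangentSingle (y : ∀ j, Y j) (j : Fin n) :
    TangentSpace (I j) (y j) →ₗ[𝕜] TangentSpace (ModelWithCorners.pi I) y :=
  LinearMap.single 𝕜 E j

/-- The direct product action `σ(a_1, …, a_n) = (σ_1(a_1), …, σ_n(a_n))`. -/
def productAction {d : Type*} [AddCommGroup d] [Module 𝕜 d]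
    (σ : ∀ j, d →ₗ[𝕜] ∀ y : Y j, TangentSpace (I j) y) :
    (Fin n → d) →ₗ[𝕜] ∀ y : (∀ j, Y j), TangentSpace (ModelWithCorners.pi I) y where
  toFun a y := ∑ j, tangentSingle I y j (σ j (a j) (y j))
  map_add' a a' := by
    funext y
    simp [Finset.sum_add_distrib]
  map_smul' c a := by
    funext y
    simp [Finset.smul_sum]

variable {g : Type*} [LieRing g] [LieAlgebra 𝕜 g] {ι : Type*} [Fintype ι]

/-- The bivector field
`(π_1, …, π_n) - ∑_{j < k} ∑ᵢ (0, …, ρ_j(ξᵢ), …, 0) ∧ (0, …, λ_k(xᵢ), …, 0)` on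
`Y_1 × ⋯ × Y_n`, where `ρ_j(ξᵢ)` is in the `j`-th entry and `λ_k(xᵢ)` is in the `k`-th entry,
`ρ_j = -σ_j|_{g*}`, `λ_k = σ_k|_g`, `(xᵢ)` is a basis of `g` and `(ξᵢ)` the dual basis of `g*`. -/
def polyMixedProduct (B : LieBialgebra 𝕜 g) (b : Basis ι 𝕜 g)
    (π : ∀ j, ∀ y : Y j, Tensor2 𝕜 (TangentSpace (I j) y))
    (σ : ∀ j, B.Double →ₗ[𝕜] ∀ y : Y j, TangentSpace (I j) y) (y : ∀ j, Y j) :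
    Tensor2 𝕜 (TangentSpace (ModelWithCorners.pi I) y) :=
  ∑ j, Tensor2.map (tangentSingle I y j) (π j (y j)) -
    ∑ j, ∑ k ∈ Finset.Ioi j, ∑ i,
      wedge 𝕜 (tangentSingle I y j (restrictRight (I j) B (σ j) (B.toDualLie (b.coord i)) (y j)))
        (tangentSingle I y k (restrictLeft (I k) B (σ k) (b i) (y k)))

end ManyFold

end Manifold

end PoissonLie
end

open PoissonLie
open scoped Manifold ContDiff

/-! The bivector field π_Y differs from the direct product by wedges of vector fields generated by
the actions of `d`, so each condition on it reduces, point by point, to an identity in `d`. A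
covector α at a point of Y, restricted to the j-th factor and pulled back along σ_j, is a functional
on `d`, represented through the form by some u_j in `d`. Let c_0, ..., c_n be the sequence with
c_{j+1} - c_j = u_j, c_0 in g* and c_n in g (`partialRep`). It governs both sides of the theorem.

On the algebraic side, splitting the representative of α in `d^n` along the n-uble only distributes
the c_j over the positions, and the co-bracket of `d^n` at a becomes the sum over j of ⟨a_j, [c_j,
c'_j]⟩ - ⟨a_j, [c_{j+1}, c'_{j+1}]⟩ (`polyubleTriple_cobracket_apply`). On the geometric side,
contracting the mixed term with α gives in the j-th factor the vector σ_j(c_j + pr_{g*} u_j)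
(`mixedTerm_eq`, `mixedRep`).

The axioms of the factors then turn half of [π_Y, π_Y], on three covectors, into a sum over j of
expressions in the bracket and the co-bracket of `d`. The j-th summand is the increment from j to j
+ 1 of -⟨c_j, [c'_j, c''_j]⟩ (`form_lie_add_sub`), so the sum telescopes (`sum_cobracket_mixedRep`);
both ends vanish because g* and g are isotropic subalgebras. The compatibility of σ with π_Y holds
factor by factor, by `polyubleDouble_cobracket_eq`.

The calculus takes place on vector spaces (`isFlatPoissonSpaceAt_flatMixedProduct`). It carries over
to manifolds because the axioms at y can be read in the chart centred at y, whose differential at y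
is the identity (`isLeftPoissonSpace_iff`).

The first claim follows from the values of the co-bracket of `d` on g and on g*: it restricts to
that of g and to the negative of that of g*. The third holds because the projection to two factors
kills every wedge but those of that pair. -/

noncomputable section

namespace PoissonLie

open Module

/-! ### Co-brackets of the doubles of Lagrangian splittings. -/

section Algebra

variable {𝕜 : Type*} [Field 𝕜]

namespace ManinTriple

variable {q : Type*} [LieRing q] [LieAlgebra 𝕜 q] (M : ManinTriple 𝕜 q)

lemma form_lie_cyclic (x y z : q) : M.form y ⁅z, x⁆ = M.form x ⁅y, z⁆ := by
  rw [← M.invariant, M.symm]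

/-- Both sides are expansions of the cubic form `⟨x, [y, z]⟩` along `c + u`, with the terms sorted
by means of the splitting `u = x + ξ`; the subalgebras `l` and `l'` being isotropic, the cubic form
vanishes on each of them. -/
lemma form_lie_add_sub (c c' c'' : q) {x y z ξ η ζ : q} (hx : x ∈ M.l) (hy : y ∈ M.l)
    (hz : z ∈ M.l) (hξ : ξ ∈ M.l') (hη : η ∈ M.l') (hζ : ζ ∈ M.l') :
    M.form (c + (x + ξ)) ⁅c' + (y + η), c'' + (z + ζ)⁆ - M.form c ⁅c', c''⁆ =
      (M.form (x + ξ) ⁅c' + η, c'' + ζ⁆ - (M.form (c + ξ) ⁅η, ζ⁆ - M.form (c + ξ) ⁅y, z⁆)) +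
      (M.form (y + η) ⁅c'' + ζ, c + ξ⁆ - (M.form (c' + η) ⁅ζ, ξ⁆ - M.form (c' + η) ⁅z, x⁆)) +
      (M.form (z + ζ) ⁅c + ξ, c' + η⁆ - (M.form (c'' + ζ) ⁅ξ, η⁆ - M.form (c'' + ζ) ⁅x, y⁆)) := by
  have h1 : M.form x ⁅y, z⁆ = 0 := M.isotropic _ hx _ (M.l.lie_mem hy hz)
  have h2 : M.form ξ ⁅η, ζ⁆ = 0 := M.isotropic' _ hξ _ (M.l'.lie_mem hη hζ)
  have hl : ∀ a b d : q, M.form b ⁅d, a⁆ = M.form a ⁅b, d⁆ := M.form_lie_cyclic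
  have hr : ∀ a b d : q, M.form d ⁅a, b⁆ = M.form a ⁅b, d⁆ := fun a b d => by
    rw [hl b d a, hl a b d]
  simp only [map_add, LinearMap.add_apply, add_lie, lie_add]
  simp only [hl c, hl x, hl ξ, hr c, hr x, hr ξ, h1, h2]
  ring

variable [FiniteDimensional 𝕜 q]

/-- On the diagonal, the functional represented by x + ξ is the pairing with (ξ, -x) in l' ⊕ l, the
second copy of the form having the opposite sign. The co-bracket pairs (a, a) with the bracket of
two such elements. -/
lemma doubleBialgebra_cobracket_apply (a : q) {α β : Dual 𝕜 q} {x y ξ η : q} (hx : x ∈ M.l)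
    (hy : y ∈ M.l) (hξ : ξ ∈ M.l') (hη : η ∈ M.l') (hα : ∀ c, α c = M.form (x + ξ) c)
    (hβ : ∀ c, β c = M.form (y + η) c) :
    M.doubleBialgebra.cobracket a α β = M.form a ⁅ξ, η⁆ - M.form a ⁅x, y⁆ := by
  have key : ∀ {α : Dual 𝕜 q} {x ξ : q} (hx : x ∈ M.l) (hξ : ξ ∈ M.l')
      (_ : ∀ c, α c = M.form (x + ξ) c),
      M.diagEquiv.toLinearEquiv.toLinearMap.dualMap α =
        M.double.dualEquiv ⟨(ξ, -x), hξ, neg_mem hx⟩ := by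
    rintro α x ξ hx hξ h
    ext ⟨⟨c, c'⟩, hc⟩
    change c = c' at hc
    subst hc
    change α c = M.form ξ c - M.form (-x) c
    simp only [h, map_add, map_neg, LinearMap.add_apply, LinearMap.neg_apply]
    ring
  change M.double.cobracket (M.diagEquiv.symm a) _ _ = _
  rw [key hx hξ hα, key hy hη hβ, cobracket_apply]
  change M.form a ⁅ξ, η⁆ - M.form a ⁅-x, -y⁆ = _
  simp

/-- For the alternating form, α is represented by (-1)^j (c (j + 1) - c j) in position j. In each
position one of the two terms belongs to the first Lagrangian subalgebra and the other to the
second, in alternation with the parity of j: positions 2k and 2k + 1 share c (2k + 1) in the first,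
positions 2k + 1 and 2k + 2 share -c (2k + 2) in the second. The conditions on c 0 and c n are
exactly those imposed at the two ends, and the sign of the form makes the summands uniform in j. -/
lemma polyubleTriple_cobracket_apply {n : ℕ} (a : Fin n → q) {α β : Dual 𝕜 (Fin n → q)}
    {c c' : ℕ → q} (h0 : c 0 ∈ M.l') (h0' : c' 0 ∈ M.l') (hn : c n ∈ M.l) (hn' : c' n ∈ M.l)
    (hα : ∀ (j : Fin n) x, α (Pi.single j x) = M.form (c (j + 1) - c j) x)
    (hβ : ∀ (j : Fin n) x, β (Pi.single j x) = M.form (c' (j + 1) - c' j) x) :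
    (polyubleTriple M n).doubleBialgebra.cobracket a α β =
      ∑ j : Fin n, (M.form (a j) ⁅c j, c' j⁆ - M.form (a j) ⁅c (j + 1), c' (j + 1)⁆) := by
  have key : ∀ {α : Dual 𝕜 (Fin n → q)} {c : ℕ → q} (_ : c 0 ∈ M.l') (_ : c n ∈ M.l)
      (_ : ∀ (j : Fin n) x, α (Pi.single j x) = M.form (c (j + 1) - c j) x),
      (fun i : Fin n => if Even (i : ℕ) then c (i + 1) else c i) ∈ (polyubleTriple M n).l ∧
      (fun i : Fin n => if Even (i : ℕ) then -c i else -c (i + 1)) ∈ (polyubleTriple M n).l' ∧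
      ∀ b, α b = (polyubleTriple M n).form
        ((fun i : Fin n => if Even (i : ℕ) then c (i + 1) else c i) +
          (fun i : Fin n => if Even (i : ℕ) then -c i else -c (i + 1))) b := by
    intro α c h0 hn h
    refine ⟨?_, ⟨?_, ?_⟩, ?_⟩
    · intro i hi
      refine ⟨fun hi' => ?_, fun hi' => ?_⟩
      · have h1 : ¬ Even ((i : ℕ) + 1) := by simpa [Nat.even_add_one] using hi
        simp [hi, h1]
      · simpa [hi, hi'] using hn
    · intro i hi
      simpa [hi] using h0
    · intro i hi
      have h2 : ¬ Even (i : ℕ) := by simpa using hi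
      refine ⟨fun hi' => ?_, fun hi' => ?_⟩
      · have h1 : Even ((i : ℕ) + 1) := by simpa [Nat.even_add_one] using hi
        simp [h2, h1]
      · simpa [h2, hi'] using hn
    · intro b
      change α b = polyubleForm M n _ b
      rw [polyubleForm_apply]
      conv_lhs => rw [← Finset.univ_sum_single b]
      rw [map_sum]
      refine Finset.sum_congr rfl fun j _ => ?_
      rw [h]
      rcases Nat.even_or_odd (j : ℕ) with hj | hj
      · simp [hj, hj.neg_one_pow, sub_eq_add_neg]
      · have h2 : ¬ Even (j : ℕ) := by simpa using hj
        simp [h2, hj.neg_one_pow, sub_eq_add_neg]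
  obtain ⟨hp, hm, hr⟩ := key h0 hn hα
  obtain ⟨hp', hm', hr'⟩ := key h0' hn' hβ
  rw [(polyubleTriple M n).doubleBialgebra_cobracket_apply a hp hp' hm hm' hr hr']
  change polyubleForm M n _ _ - polyubleForm M n _ _ = _
  rw [polyubleForm_apply, polyubleForm_apply, ← Finset.sum_sub_distrib]
  refine Finset.sum_congr rfl fun j _ => ?_
  rcases Nat.even_or_odd (j : ℕ) with hj | hj
  · simp [hj, hj.neg_one_pow]
  · have h2 : ¬ Even (j : ℕ) := by simpa using hj
    simp [h2, hj.neg_one_pow, neg_add_eq_sub]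

end ManinTriple

/-! ### The double of a Lie bialgebra: representatives of functionals and restrictions of the
co-bracket. -/

namespace LieBialgebra

variable {g : Type*} [LieRing g] [LieAlgebra 𝕜 g] (B : LieBialgebra 𝕜 g)

@[simp] lemma inl_fst (x : g) : (B.inl x).1 = x := rfl
@[simp] lemma inl_snd (x : g) : (B.inl x).2 = 0 := rfl
@[simp] lemma inr_fst (ξ : B.DualLie) : (B.inr ξ).1 = 0 := rfl
@[simp] lemma inr_snd (ξ : B.DualLie) : (B.inr ξ).2 = ξ := rfl

/-- The projection of the double `g ⊕ g*` to `g`. -/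
def projLeft : B.Double →ₗ[𝕜] B.Double := B.inl ∘ₗ LinearMap.fst 𝕜 g B.DualLie

/-- The projection of the double `g ⊕ g*` to `g*`. -/
def projRight : B.Double →ₗ[𝕜] B.Double := B.inr ∘ₗ LinearMap.snd 𝕜 g B.DualLie

lemma projLeft_add_projRight (a : B.Double) : B.projLeft a + B.projRight a = a :=
  Prod.ext (add_zero _) (zero_add _)

variable [FiniteDimensional 𝕜 g]

lemma projLeft_mem (a : B.Double) : B.projLeft a ∈ B.maninTriple.l := rfl

lemma projRight_mem (a : B.Double) : B.projRight a ∈ B.maninTriple.l' := rfl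

/-- The element of the double which represents a linear functional through the form. -/
def formRep : Dual 𝕜 B.Double →ₗ[𝕜] B.Double :=
  B.inl ∘ₗ (evalEquiv 𝕜 g).symm.toLinearMap ∘ₗ (B.inr ∘ₗ B.toDualLie.toLinearMap).dualMap +
    B.inr ∘ₗ B.toDualLie.toLinearMap ∘ₗ B.inl.dualMap

lemma formRep_fst (φ : Dual 𝕜 B.Double) (ξ : Dual 𝕜 g) :
    ξ (B.formRep φ).1 = φ (B.inr (B.toDualLie ξ)) := by
  have h : (B.formRep φ).1 =
      (evalEquiv 𝕜 g).symm ((B.inr ∘ₗ B.toDualLie.toLinearMap).dualMap φ) := add_zero _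
  rw [h]
  exact LinearMap.congr_fun (LinearEquiv.apply_symm_apply (evalEquiv 𝕜 g) _) ξ

lemma formRep_snd (φ : Dual 𝕜 B.Double) (x : g) :
    B.toDualLie.symm (B.formRep φ).2 x = φ (B.inl x) := by
  have h : (B.formRep φ).2 = B.toDualLie (B.inl.dualMap φ) := zero_add _
  rw [h, LinearEquiv.symm_apply_apply]
  rfl

lemma form_formRep (φ : Dual 𝕜 B.Double) (a : B.Double) :
    B.maninTriple.form (B.formRep φ) a = φ a := by
  change B.doubleForm _ _ = _
  rw [doubleForm_apply, B.formRep_fst φ (B.toDualLie.symm a.2), formRep_snd, add_comm, ← map_add]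
  exact congrArg φ (Prod.ext (add_zero _) (zero_add _))

variable {ι : Type*} [Fintype ι] (b : Basis ι 𝕜 g)

/-- This and `sum_inl_smul_inr` remove the basis from the mixed term: contracting the canonical
element of g ⊗ g* with a functional extracts one half of its representative. -/
lemma sum_inr_smul_inl (φ : Dual 𝕜 B.Double) :
    ∑ i, φ (B.inr (B.toDualLie (b.coord i))) • B.inl (b i) = B.projLeft (B.formRep φ) := by
  simp only [← formRep_fst, ← map_smul, ← map_sum]
  exact congrArg B.inl (b.sum_repr _)

lemma sum_inl_smul_inr (φ : Dual 𝕜 B.Double) :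
    ∑ i, φ (B.inl (b i)) • B.inr (B.toDualLie (b.coord i)) = B.projRight (B.formRep φ) := by
  simp only [← formRep_snd, ← map_smul, ← map_sum]
  refine congrArg B.inr (B.toDualLie.symm.injective ?_)
  rw [LinearEquiv.symm_apply_apply]
  refine b.ext fun i => ?_
  simp
  rfl

lemma doubleBialgebra_cobracket_apply (a : B.Double) (φ ψ : Dual 𝕜 B.Double) :
    B.doubleBialgebra.cobracket a φ ψ =
      B.maninTriple.form a ⁅B.projRight (B.formRep φ), B.projRight (B.formRep ψ)⁆ -
      B.maninTriple.form a ⁅B.projLeft (B.formRep φ), B.projLeft (B.formRep ψ)⁆ :=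
  B.maninTriple.doubleBialgebra_cobracket_apply a (B.projLeft_mem _) (B.projLeft_mem _)
    (B.projRight_mem _) (B.projRight_mem _)
    (fun c => by rw [projLeft_add_projRight, form_formRep])
    (fun c => by rw [projLeft_add_projRight, form_formRep])

lemma inl_lie (x y : g) : B.inl ⁅x, y⁆ = ⁅B.inl x, B.inl y⁆ := by
  apply Double.ext <;> intro z
  · rw [Double.apply_fst_bracket]; simp
  · rw [Double.snd_bracket_apply]; simp

lemma inr_lie (ξ η : B.DualLie) : B.inr ⁅ξ, η⁆ = ⁅B.inr ξ, B.inr η⁆ := by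
  apply Double.ext <;> intro z
  · rw [Double.apply_fst_bracket]; simp
  · rw [Double.snd_bracket_apply]; simp [dualLie_bracket]

/-- Since g is an isotropic subalgebra, the term with the brackets of the g-parts pairs to zero with
x. The bracket of the g*-parts remains, and it is dual to the co-bracket of g. -/
lemma doubleBialgebra_cobracket_inl (x : g) (φ ψ : Dual 𝕜 B.Double) :
    B.doubleBialgebra.cobracket (B.inl x) φ ψ = B.cobracket x (φ ∘ₗ B.inl) (ψ ∘ₗ B.inl) := by
  have h : ∀ φ : Dual 𝕜 B.Double, B.toDualLie.symm (B.formRep φ).2 = φ ∘ₗ B.inl := fun φ =>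
    LinearMap.ext fun x => B.formRep_snd φ x
  rw [doubleBialgebra_cobracket_apply, ← h, ← h]
  change B.doubleForm (B.inl x) ⁅B.inr (B.formRep φ).2, B.inr (B.formRep ψ).2⁆ -
    B.doubleForm (B.inl x) ⁅B.inl (B.formRep φ).1, B.inl (B.formRep ψ).1⁆ = _
  rw [← inr_lie, ← inl_lie, doubleForm_apply, doubleForm_apply]
  simp [dualLie_bracket]

/-- Here the bracket of the g-parts is the one that survives, and it enters with a minus sign. This
sign is the reason for the sign in the definition of `restrictRight`. -/
lemma doubleBialgebra_cobracket_inr (ξ : B.DualLie) (φ ψ : Dual 𝕜 B.Double) :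
    B.doubleBialgebra.cobracket (B.inr ξ) φ ψ =
      -B.dual.cobracket ξ (φ ∘ₗ B.inr) (ψ ∘ₗ B.inr) := by
  have h : ∀ φ : Dual 𝕜 B.Double, B.bidual.symm (φ ∘ₗ B.inr) = (B.formRep φ).1 := fun φ =>
    (LinearEquiv.symm_apply_eq _).2 <| LinearMap.ext fun ξ =>
      (B.formRep_fst φ (B.toDualLie.symm ξ)).symm
  rw [doubleBialgebra_cobracket_apply]
  change B.doubleForm (B.inr ξ) ⁅B.inr (B.formRep φ).2, B.inr (B.formRep ψ).2⁆ -
    B.doubleForm (B.inr ξ) ⁅B.inl (B.formRep φ).1, B.inl (B.formRep ψ).1⁆ =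
    -B.toDualLie.symm ξ ⁅B.bidual.symm (φ ∘ₗ B.inr), B.bidual.symm (ψ ∘ₗ B.inr)⁆
  rw [← inr_lie, ← inl_lie, doubleForm_apply, doubleForm_apply, h, h]
  simp

/-! ### Partial sums of representatives, the contracted mixed term and the co-bracket of `d^n`. -/

variable {n : ℕ}

/-- The partial sums of the elements of the double which represent the functionals `φ j`, shifted
so that the first one is in `g*` and the last one is in `g`. -/
def partialRep (φ : Fin n → Dual 𝕜 B.Double) (m : ℕ) : B.Double :=
  ∑ j ∈ Finset.univ.filter (fun j : Fin n => (j : ℕ) < m), B.formRep (φ j) - B.projRight (∑ j, B.formRep (φ j))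

lemma partialRep_zero_mem (φ : Fin n → Dual 𝕜 B.Double) :
    B.partialRep φ 0 ∈ B.maninTriple.l' := by
  simpa [partialRep] using B.projRight_mem (∑ j, B.formRep (φ j))

lemma partialRep_last_mem (φ : Fin n → Dual 𝕜 B.Double) :
    B.partialRep φ n ∈ B.maninTriple.l := by
  have h : B.partialRep φ n = B.projLeft (∑ j, B.formRep (φ j)) := by
    rw [partialRep, sub_eq_iff_eq_add, projLeft_add_projRight]
    exact Finset.sum_congr (by simp) fun _ _ => rfl
  rw [h]
  exact B.projLeft_mem _

lemma partialRep_succ (φ : Fin n → Dual 𝕜 B.Double) (j : Fin n) :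
    B.partialRep φ (j + 1) = B.partialRep φ j + B.formRep (φ j) := by
  have h : (Finset.univ.filter fun i : Fin n => (i : ℕ) < j + 1) =
      insert j (Finset.univ.filter fun i : Fin n => (i : ℕ) < j) := by
    ext i
    simp [Fin.ext_iff]
    omega
  rw [partialRep, partialRep, h, Finset.sum_insert (by simp)]
  abel

/-- The element `a j` of the double such that the `j`-th component of the mixed term, contracted
with the functionals `φ`, is the negative of the vector defined by `a j`. -/
def mixedRep (φ : Fin n → Dual 𝕜 B.Double) (j : Fin n) : B.Double :=
  B.partialRep φ j + B.projRight (B.formRep (φ j))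

lemma polyubleDouble_cobracket_apply (a : Fin n → B.Double) (φ ψ : Dual 𝕜 (Fin n → B.Double)) :
    (B.polyubleDouble n).cobracket a φ ψ = ∑ j : Fin n,
      (B.maninTriple.form (a j)
        ⁅B.partialRep (fun j => φ ∘ₗ LinearMap.single 𝕜 (fun _ => B.Double) j) j,
          B.partialRep (fun j => ψ ∘ₗ LinearMap.single 𝕜 (fun _ => B.Double) j) j⁆ -
      B.maninTriple.form (a j)
        ⁅B.partialRep (fun j => φ ∘ₗ LinearMap.single 𝕜 (fun _ => B.Double) j) (j + 1),
          B.partialRep (fun j => ψ ∘ₗ LinearMap.single 𝕜 (fun _ => B.Double) j) (j + 1)⁆) := by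
  apply B.maninTriple.polyubleTriple_cobracket_apply a (B.partialRep_zero_mem _)
    (B.partialRep_zero_mem _) (B.partialRep_last_mem _) (B.partialRep_last_mem _)
  all_goals
    intro j x
    rw [partialRep_succ, add_sub_cancel_left, form_formRep]
    rfl

/-- The mixed term `∑_{j < k} ∑ᵢ (ξᵢ)_j ∧ (xᵢ)_k` on the functionals `φ`, `ψ` on the power of the
double. -/
def mixedTerm (φ ψ : Fin n → Dual 𝕜 B.Double) : 𝕜 :=
  ∑ j, ∑ k ∈ Finset.Ioi j, ∑ i,
    (φ j (B.inr (B.toDualLie (b.coord i))) * ψ k (B.inl (b i)) -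
      φ k (B.inl (b i)) * ψ j (B.inr (B.toDualLie (b.coord i))))

omit [FiniteDimensional 𝕜 g] in
lemma mixedTerm_swap (φ ψ : Fin n → Dual 𝕜 B.Double) :
    B.mixedTerm b φ ψ = -B.mixedTerm b ψ φ := by
  simp only [mixedTerm, ← Finset.sum_neg_distrib]
  refine Finset.sum_congr rfl fun j _ => Finset.sum_congr rfl fun k _ =>
    Finset.sum_congr rfl fun i _ => ?_
  ring

/-- Write u_k for the representative of `ψ k`. Collecting the terms in `φ j` gives the g*-parts of
u_k for k > j minus the g-parts of u_k for k < j. In `mixedRep ψ j`, the shift by the g*-part of the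
total cancels the g*-parts for k ≤ j, which leaves the negative of the same expression. -/
lemma mixedTerm_eq (φ ψ : Fin n → Dual 𝕜 B.Double) :
    B.mixedTerm b φ ψ = -∑ j, φ j (B.mixedRep ψ j) := by
  have h1 : B.mixedTerm b φ ψ = ∑ j, ∑ k ∈ Finset.Ioi j, φ j (B.projRight (B.formRep (ψ k))) -
      ∑ j, ∑ k ∈ Finset.Ioi j, φ k (B.projLeft (B.formRep (ψ j))) := by
    simp only [mixedTerm, ← Finset.sum_sub_distrib]
    refine Finset.sum_congr rfl fun j _ => Finset.sum_congr rfl fun k _ => ?_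
    rw [Finset.sum_sub_distrib, ← B.sum_inl_smul_inr b, ← B.sum_inr_smul_inl b, map_sum, map_sum]
    simp only [map_smul, smul_eq_mul, mul_comm]
  -- Exchanging the order of summation makes the index of φ the outer one in both sums.
  have h2 : ∑ j, ∑ k ∈ Finset.Ioi j, φ k (B.projLeft (B.formRep (ψ j))) =
      ∑ k, ∑ j ∈ Finset.Iio k, φ k (B.projLeft (B.formRep (ψ j))) :=
    Finset.sum_comm' (by simp)
  rw [h1, h2, ← Finset.sum_sub_distrib, ← Finset.sum_neg_distrib]
  refine Finset.sum_congr rfl fun j _ => ?_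
  simp only [← map_sum]
  rw [← map_sub, ← map_neg]
  congr 1
  have h3 : (Finset.univ.filter fun i : Fin n => (i : ℕ) < j) = Finset.Iio j := by
    ext i; simp
  have h4 : ∑ i, B.formRep (ψ i) = ∑ i ∈ Finset.Iio j, B.formRep (ψ i) + B.formRep (ψ j) +
      ∑ i ∈ Finset.Ioi j, B.formRep (ψ i) := by
    rw [← Finset.sum_filter_add_sum_filter_not Finset.univ (fun i => i ≤ j),
      show (Finset.univ.filter fun i : Fin n => i ≤ j) = insert j (Finset.Iio j) by
        ext i; simp [le_iff_eq_or_lt], Finset.sum_insert (by simp),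
      show (Finset.univ.filter fun i : Fin n => ¬ i ≤ j) = Finset.Ioi j by ext i; simp]
    abel
  rw [mixedRep, partialRep, h3, h4]
  have h5 : ∀ a, B.projLeft a = a - B.projRight a := fun a =>
    eq_sub_of_add_eq (B.projLeft_add_projRight a)
  simp only [map_sum, map_add, h5]
  abel

/-- The identity behind the vanishing of the Schouten bracket of a mixed product. -/
lemma sum_cobracket_mixedRep (φ ψ χ : Fin n → Dual 𝕜 B.Double) :
    ∑ j,
      (B.doubleBialgebra.cobracket (B.mixedRep φ j) (ψ j) (χ j) +
        B.doubleBialgebra.cobracket (B.mixedRep ψ j) (χ j) (φ j) +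
        B.doubleBialgebra.cobracket (B.mixedRep χ j) (φ j) (ψ j) -
        (φ j ⁅B.mixedRep ψ j, B.mixedRep χ j⁆ + ψ j ⁅B.mixedRep χ j, B.mixedRep φ j⁆ +
          χ j ⁅B.mixedRep φ j, B.mixedRep ψ j⁆)) = 0 := by
  -- The j-th summand is the increment of this cubic expression. At m = 0 all three partial sums lie
  -- in g*, at m = n all three lie in g, so it vanishes at both ends.
  let f : ℕ → 𝕜 := fun m => -B.maninTriple.form (B.partialRep φ m)
    ⁅B.partialRep ψ m, B.partialRep χ m⁆
  have hf0 : f 0 = 0 := neg_eq_zero.2 <| B.maninTriple.isotropic' _ (B.partialRep_zero_mem _) _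
    (B.maninTriple.l'.lie_mem (B.partialRep_zero_mem _) (B.partialRep_zero_mem _))
  have hfn : f n = 0 := neg_eq_zero.2 <| B.maninTriple.isotropic _ (B.partialRep_last_mem _) _
    (B.maninTriple.l.lie_mem (B.partialRep_last_mem _) (B.partialRep_last_mem _))
  have h : ∑ j : Fin n, (f (j + 1) - f j) = 0 := by
    rw [Fin.sum_univ_eq_sum_range (fun i => f (i + 1) - f i), Finset.sum_range_sub, hf0, hfn,
      sub_self]
  rw [← h]
  refine Finset.sum_congr rfl fun j _ => ?_
  have key := B.maninTriple.form_lie_add_sub (B.partialRep φ j) (B.partialRep ψ j)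
    (B.partialRep χ j) (B.projLeft_mem (B.formRep (φ j))) (B.projLeft_mem (B.formRep (ψ j)))
    (B.projLeft_mem (B.formRep (χ j))) (B.projRight_mem (B.formRep (φ j)))
    (B.projRight_mem (B.formRep (ψ j))) (B.projRight_mem (B.formRep (χ j)))
  simp only [projLeft_add_projRight] at key
  simp only [f, partialRep_succ, doubleBialgebra_cobracket_apply, ← form_formRep B (φ j),
    ← form_formRep B (ψ j), ← form_formRep B (χ j)]
  simp only [mixedRep]
  linear_combination key

/-- This form of the co-bracket has the shape of the Lie derivative of a mixed product: the first
term comes from the factors, the other two from the mixed term. With c, c' the j-th partial sums and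
u, v their increments, the j-th summand of the telescopic form is -⟨a, [u, c'] + [c, v] + [u, v]⟩,
and splitting u and v into their g- and g*-parts identifies the two expressions. -/
lemma polyubleDouble_cobracket_eq (a : Fin n → B.Double) (φ ψ : Dual 𝕜 (Fin n → B.Double)) :
    (B.polyubleDouble n).cobracket a φ ψ = ∑ j : Fin n,
      (B.doubleBialgebra.cobracket (a j) (φ ∘ₗ LinearMap.single 𝕜 (fun _ => B.Double) j)
          (ψ ∘ₗ LinearMap.single 𝕜 (fun _ => B.Double) j) +
        (φ ∘ₗ LinearMap.single 𝕜 (fun _ => B.Double) j)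
          ⁅a j, B.mixedRep (fun j => ψ ∘ₗ LinearMap.single 𝕜 (fun _ => B.Double) j) j⁆ -
        (ψ ∘ₗ LinearMap.single 𝕜 (fun _ => B.Double) j)
          ⁅a j, B.mixedRep (fun j => φ ∘ₗ LinearMap.single 𝕜 (fun _ => B.Double) j) j⁆) := by
  rw [polyubleDouble_cobracket_apply]
  refine Finset.sum_congr rfl fun j _ => ?_
  rw [partialRep_succ, partialRep_succ, doubleBialgebra_cobracket_apply, mixedRep, mixedRep,
    ← form_formRep B (φ ∘ₗ _), ← form_formRep B (ψ ∘ₗ _)]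
  generalize B.partialRep _ j = c, B.partialRep _ j = c'
  generalize B.formRep (φ ∘ₗ _) = u, B.formRep (ψ ∘ₗ _) = v, a j = a
  -- Every term is brought to the shape ⟨a, [·, ·]⟩, after which only bilinearity and skew-symmetry
  -- are needed.
  have h1 : ∀ x y, B.maninTriple.form x ⁅a, y⁆ = -B.maninTriple.form a ⁅x, y⁆ := fun x y => by
    rw [B.maninTriple.form_lie_cyclic y, B.maninTriple.form_lie_cyclic a, ← lie_skew, map_neg]
  have hu := B.projLeft_add_projRight u
  have hv := B.projLeft_add_projRight v
  generalize B.projLeft u = x, B.projRight u = ξ, B.projLeft v = y, B.projRight v = η at *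
  subst hu hv
  have h2 : ∀ x y, B.maninTriple.form a ⁅x, y⁆ = -B.maninTriple.form a ⁅y, x⁆ := fun x y => by
    rw [← lie_skew, map_neg]
  simp only [map_add, LinearMap.add_apply, h1, lie_add, add_lie, h2 y, h2 η]
  ring

end LieBialgebra

end Algebra

/-! ### Poisson spaces at a point of a vector space. -/

section Flat

variable {𝕜 : Type*} [RCLike 𝕜] {g : Type*} [LieRing g] [LieAlgebra 𝕜 g]

/-- The conditions on a left Poisson space at a point `e` of a vector space, for a field of
two-tensors `P` and an action `X`. -/
structure IsFlatPoissonSpaceAt {E : Type*} [NormedAddCommGroup E] [NormedSpace 𝕜 E]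
    (B : LieBialgebra 𝕜 g) (P : E → Tensor2 𝕜 E) (X : g →ₗ[𝕜] E → E) (e : E) : Prop where
  differentiableAt_tensor : ∀ α β, DifferentiableAt 𝕜 (fun z => P z α β) e
  differentiableAt_action : ∀ a, DifferentiableAt 𝕜 (X a) e
  alternating : ∀ α, P e α α = 0
  schouten_self : ∀ α β γ, flatSchouten P P e α β γ = 0
  map_lie : ∀ a b, X ⁅a, b⁆ e = -(fderiv 𝕜 (X b) e (X a e) - fderiv 𝕜 (X a) e (X b e))
  compat : ∀ a α β, flatLieDeriv (X a) P e α β =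
    B.cobracket a (α ∘ₗ LinearMap.proj e ∘ₗ X) (β ∘ₗ LinearMap.proj e ∘ₗ X)

section Local

variable {E : Type*} [NormedAddCommGroup E] [NormedSpace 𝕜 E]

/-- A component of the differential of a mixed product bivector field evaluated on two
covectors. -/
def mixedDifferential (P : E → Tensor2 𝕜 E) (X : g →ₗ[𝕜] E → E) (e : E) (α β : Dual 𝕜 E)
    (a b : g) : Dual 𝕜 E :=
  (fderiv 𝕜 (fun z => P z α β) e).toLinearMap - α ∘ₗ (fderiv 𝕜 (X b) e).toLinearMap +
    β ∘ₗ (fderiv 𝕜 (X a) e).toLinearMap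

lemma mixedDifferential_apply (P : E → Tensor2 𝕜 E) (X : g →ₗ[𝕜] E → E) (e : E)
    (α β : Dual 𝕜 E) (a b : g) (v : E) : mixedDifferential P X e α β a b v =
      fderiv 𝕜 (fun z => P z α β) e v - α (fderiv 𝕜 (X b) e v) + β (fderiv 𝕜 (X a) e v) := rfl

namespace IsFlatPoissonSpaceAt

variable {B : LieBialgebra 𝕜 g} {P : E → Tensor2 𝕜 E} {X : g →ₗ[𝕜] E → E} {e : E}

lemma swap (h : IsFlatPoissonSpaceAt B P X e) (α β : Dual 𝕜 E) : P e α β = -P e β α := by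
  have h1 := h.alternating (α + β)
  simp only [map_add, LinearMap.add_apply, h.alternating] at h1
  linear_combination h1

/-- The left side is the contribution of one factor to half of the Schouten bracket of a mixed
product with itself. Its terms sort by type: those with P alone cancel by [P, P] = 0, those with P
and one vector field assemble into Lie derivatives of P, hence co-brackets, and those with two
vector fields into commutators, hence brackets with a sign, the action being an anti-homomorphism.
-/
lemma sum_mixedDifferential (h : IsFlatPoissonSpaceAt B P X e) (α β γ : Dual 𝕜 E) (a b c : g) :
    P e α (mixedDifferential P X e β γ b c) + mixedDifferential P X e β γ b c (X a e) +
      (P e β (mixedDifferential P X e γ α c a) + mixedDifferential P X e γ α c a (X b e)) +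
      (P e γ (mixedDifferential P X e α β a b) + mixedDifferential P X e α β a b (X c e)) =
    B.cobracket a (β ∘ₗ LinearMap.proj e ∘ₗ X) (γ ∘ₗ LinearMap.proj e ∘ₗ X) +
      B.cobracket b (γ ∘ₗ LinearMap.proj e ∘ₗ X) (α ∘ₗ LinearMap.proj e ∘ₗ X) +
      B.cobracket c (α ∘ₗ LinearMap.proj e ∘ₗ X) (β ∘ₗ LinearMap.proj e ∘ₗ X) -
      (α (X ⁅b, c⁆ e) + β (X ⁅c, a⁆ e) + γ (X ⁅a, b⁆ e)) := by
  have h1 := h.schouten_self α β γ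
  -- For equal arguments the Schouten bracket is twice one cyclic sum.
  rw [flatSchouten, ← two_mul, mul_eq_zero_iff_left two_ne_zero] at h1
  simp only [← h.compat, flatLieDeriv, mixedDifferential_apply, h.map_lie, map_neg, map_sub]
  simp only [mixedDifferential, map_add, map_sub]
  rw [h.swap (β ∘ₗ _) γ, h.swap (γ ∘ₗ _) α, h.swap (α ∘ₗ _) β]
  linear_combination h1

/-- The left side is the contribution of one factor to the Lie derivative of a mixed product along
the action. The terms with P give the co-bracket at x; the others are commutators of `X x` with `X
a` and `X b`. -/
lemma lieDeriv_mixedDifferential (h : IsFlatPoissonSpaceAt B P X e) (α β : Dual 𝕜 E)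
    (x a b : g) :
    mixedDifferential P X e α β a b (X x e) +
      (P e β (α ∘ₗ (fderiv 𝕜 (X x) e).toLinearMap) + α (fderiv 𝕜 (X x) e (X b e))) -
      (P e α (β ∘ₗ (fderiv 𝕜 (X x) e).toLinearMap) + β (fderiv 𝕜 (X x) e (X a e))) =
    B.cobracket x (α ∘ₗ LinearMap.proj e ∘ₗ X) (β ∘ₗ LinearMap.proj e ∘ₗ X) +
      α (X ⁅x, b⁆ e) - β (X ⁅x, a⁆ e) := by
  simp only [← h.compat, flatLieDeriv, mixedDifferential_apply, h.map_lie, map_neg, map_sub]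
  rw [h.swap (α ∘ₗ _) β]
  ring

end IsFlatPoissonSpaceAt

end Local

/-! ### Mixed products on products of vector spaces. -/

section Product

variable {n : ℕ} {E : Fin n → Type*} [∀ j, NormedAddCommGroup (E j)] [∀ j, NormedSpace 𝕜 (E j)]
  {ι : Type*} [Fintype ι]

/-- The mixed product bivector field on a product of vector spaces. -/
def flatMixedProduct (B : LieBialgebra 𝕜 g) (b : Basis ι 𝕜 g) (P : ∀ j, E j → Tensor2 𝕜 (E j))
    (X : ∀ j, B.Double →ₗ[𝕜] E j → E j) (z : ∀ j, E j) : Tensor2 𝕜 (∀ j, E j) :=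
  ∑ j, Tensor2.map (LinearMap.single 𝕜 E j) (P j (z j)) -
    ∑ j, ∑ k ∈ Finset.Ioi j, ∑ i,
      wedge 𝕜 (LinearMap.single 𝕜 E j (-X j (B.inr (B.toDualLie (b.coord i))) (z j)))
        (LinearMap.single 𝕜 E k (X k (B.inl (b i)) (z k)))

/-- The direct product action on a product of vector spaces. -/
def flatProductAction {d : Type*} [AddCommGroup d] [Module 𝕜 d] (X : ∀ j, d →ₗ[𝕜] E j → E j) :
    (Fin n → d) →ₗ[𝕜] (∀ j, E j) → ∀ j, E j where
  toFun a z j := X j (a j) (z j)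
  map_add' a a' := by funext z j; simp
  map_smul' c a := by funext z j; simp

/-- The sign in ρ = -σ on g* cancels the one in front of the wedges, so the mixed term enters with a
plus. -/
lemma flatMixedProduct_apply (B : LieBialgebra 𝕜 g) (b : Basis ι 𝕜 g)
    (P : ∀ j, E j → Tensor2 𝕜 (E j)) (X : ∀ j, B.Double →ₗ[𝕜] E j → E j) (z : ∀ j, E j)
    (α β : Dual 𝕜 (∀ j, E j)) : flatMixedProduct B b P X z α β =
      ∑ j, P j (z j) (α ∘ₗ LinearMap.single 𝕜 E j) (β ∘ₗ LinearMap.single 𝕜 E j) +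
      B.mixedTerm b
        (fun j => (α ∘ₗ LinearMap.single 𝕜 E j) ∘ₗ LinearMap.proj (z j) ∘ₗ X j)
        (fun j => (β ∘ₗ LinearMap.single 𝕜 E j) ∘ₗ LinearMap.proj (z j) ∘ₗ X j) := by
  simp only [flatMixedProduct, LieBialgebra.mixedTerm, LinearMap.sub_apply,
    LinearMap.sum_apply]
  rw [sub_eq_add_neg]
  simp only [← Finset.sum_neg_distrib]
  congr 1
  refine Finset.sum_congr rfl fun j _ => Finset.sum_congr rfl fun k _ =>
    Finset.sum_congr rfl fun i _ => ?_
  simp only [wedge, LinearMap.mk₂_apply, map_neg, LinearMap.comp_apply, LinearMap.proj_apply]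
  ring

lemma flatMixedProduct_alternating (B : LieBialgebra 𝕜 g) (b : Basis ι 𝕜 g)
    {P : ∀ j, E j → Tensor2 𝕜 (E j)} (X : ∀ j, B.Double →ₗ[𝕜] E j → E j) {z : ∀ j, E j}
    (h : ∀ j α, P j (z j) α α = 0) (α : Dual 𝕜 (∀ j, E j)) :
    flatMixedProduct B b P X z α α = 0 := by
  rw [flatMixedProduct_apply, Finset.sum_eq_zero fun j _ => h j _, zero_add]
  simp only [LieBialgebra.mixedTerm]
  refine Finset.sum_eq_zero fun j _ => Finset.sum_eq_zero fun k _ =>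
    Finset.sum_eq_zero fun i _ => ?_
  ring

lemma flatMixedProduct_swap (B : LieBialgebra 𝕜 g) (b : Basis ι 𝕜 g)
    {P : ∀ j, E j → Tensor2 𝕜 (E j)} (X : ∀ j, B.Double →ₗ[𝕜] E j → E j) {z : ∀ j, E j}
    (h : ∀ j α, P j (z j) α α = 0) (α β : Dual 𝕜 (∀ j, E j)) :
    flatMixedProduct B b P X z α β = -flatMixedProduct B b P X z β α := by
  have h1 := flatMixedProduct_alternating B b X h (α + β)
  simp only [map_add, LinearMap.add_apply, flatMixedProduct_alternating B b X h] at h1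
  linear_combination h1

variable [FiniteDimensional 𝕜 g]

/-- The element of the double by which a covector at `e` acts in the `j`-th component, through
the mixed term. -/
abbrev covectorRep (B : LieBialgebra 𝕜 g) (X : ∀ j, B.Double →ₗ[𝕜] E j → E j) (e : ∀ j, E j)
    (α : Dual 𝕜 (∀ j, E j)) : Fin n → B.Double :=
  B.mixedRep fun j => (α ∘ₗ LinearMap.single 𝕜 E j) ∘ₗ LinearMap.proj (e j) ∘ₗ X j

/-- Contraction with α in the first slot becomes diagonal in the factors: each one contributes its
own tensor and a vector of its own action. The other factors are felt only through `covectorRep`. -/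
lemma flatMixedProduct_apply_eq_sum (B : LieBialgebra 𝕜 g) (b : Basis ι 𝕜 g)
    (P : ∀ j, E j → Tensor2 𝕜 (E j)) (X : ∀ j, B.Double →ₗ[𝕜] E j → E j) (z : ∀ j, E j)
    (α β : Dual 𝕜 (∀ j, E j)) : flatMixedProduct B b P X z α β =
      ∑ j, (P j (z j) (α ∘ₗ LinearMap.single 𝕜 E j) (β ∘ₗ LinearMap.single 𝕜 E j) +
        (β ∘ₗ LinearMap.single 𝕜 E j) (X j (covectorRep B X z α j) (z j))) := by
  rw [flatMixedProduct_apply, LieBialgebra.mixedTerm_swap, LieBialgebra.mixedTerm_eq, neg_neg,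
    Finset.sum_add_distrib]
  rfl

lemma hasFDerivAt_comp_apply {F : Type*} [NormedAddCommGroup F] [NormedSpace 𝕜 F] {j : Fin n}
    {f : E j → F} {e : ∀ j, E j} (hf : DifferentiableAt 𝕜 f (e j)) :
    HasFDerivAt (fun z : ∀ j, E j => f (z j))
      ((fderiv 𝕜 f (e j)).comp (ContinuousLinearMap.proj j)) e :=
  HasFDerivAt.comp e (f := fun z : ∀ j, E j => z j) hf.hasFDerivAt
    (ContinuousLinearMap.proj (R := 𝕜) (φ := E) j).hasFDerivAt

lemma hasFDerivAt_dual_comp {F G : Type*} [NormedAddCommGroup F] [NormedSpace 𝕜 F]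
    [NormedAddCommGroup G] [NormedSpace 𝕜 G] [FiniteDimensional 𝕜 G] (α : Dual 𝕜 G)
    {f : F → G} {e : F} (hf : DifferentiableAt 𝕜 f e) :
    HasFDerivAt (fun z => α (f z)) (α.toContinuousLinearMap.comp (fderiv 𝕜 f e)) e :=
  α.toContinuousLinearMap.hasFDerivAt.comp e hf.hasFDerivAt

/-- The derivative along `v` of the functional `a ↦ α (X a)`. -/
def derivFunctional {d F : Type*} [AddCommGroup d] [Module 𝕜 d] [NormedAddCommGroup F]
    [NormedSpace 𝕜 F] {X : d →ₗ[𝕜] F → F} {e : F} (hX : ∀ a, DifferentiableAt 𝕜 (X a) e)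
    (α : Dual 𝕜 F) (v : F) : Dual 𝕜 d where
  toFun a := α (fderiv 𝕜 (X a) e v)
  map_add' a a' := by
    rw [map_add, fderiv_add (hX a) (hX a')]
    simp
  map_smul' c a := by
    rw [map_smul, fderiv_const_smul (hX a)]
    simp

variable [∀ j, FiniteDimensional 𝕜 (E j)]

/-- The mixed term is bilinear in the functionals a ↦ α_j(X_j a) and a ↦ β_j(X_j a), so the product
rule yields two mixed terms, each with one family differentiated. With the differentiated family
moved to the first slot, `mixedTerm_eq` pairs it with representatives taken at e, and these never
have to be differentiated themselves. -/
lemma hasFDerivAt_flatMixedProduct {B : LieBialgebra 𝕜 g} (b : Basis ι 𝕜 g)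
    {P : ∀ j, E j → Tensor2 𝕜 (E j)} {X : ∀ j, B.Double →ₗ[𝕜] E j → E j} {e : ∀ j, E j}
    (hP : ∀ j α β, DifferentiableAt 𝕜 (fun z => P j z α β) (e j))
    (hX : ∀ j a, DifferentiableAt 𝕜 (X j a) (e j)) (α β : Dual 𝕜 (∀ j, E j)) :
    HasFDerivAt (fun z => flatMixedProduct B b P X z α β)
      (∑ j, (mixedDifferential (P j) (X j) (e j) (α ∘ₗ LinearMap.single 𝕜 E j)
        (β ∘ₗ LinearMap.single 𝕜 E j) (covectorRep B X e α j)
        (covectorRep B X e β j)).toContinuousLinearMap.comp (ContinuousLinearMap.proj j)) e := by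
  simp only [flatMixedProduct_apply]
  have hc : ∀ (γ : Dual 𝕜 (∀ j, E j)) (j : Fin n) (a : B.Double), HasFDerivAt
      (fun z : ∀ j, E j => (γ ∘ₗ LinearMap.single 𝕜 E j) (X j a (z j)))
      (((γ ∘ₗ LinearMap.single 𝕜 E j).toContinuousLinearMap.comp (fderiv 𝕜 (X j a) (e j))).comp
        (ContinuousLinearMap.proj j)) e := fun γ j a =>
    HasFDerivAt.comp e (f := fun z : ∀ j, E j => z j)
      (hasFDerivAt_dual_comp (γ ∘ₗ LinearMap.single 𝕜 E j) (hX j a))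
      (ContinuousLinearMap.proj (R := 𝕜) (φ := E) j).hasFDerivAt
  have h := (HasFDerivAt.fun_sum (u := Finset.univ) fun j _ => hasFDerivAt_comp_apply
    (hP j (α ∘ₗ LinearMap.single 𝕜 E j) (β ∘ₗ LinearMap.single 𝕜 E j))).add
    (HasFDerivAt.fun_sum (u := Finset.univ) fun j _ => HasFDerivAt.fun_sum (u := Finset.Ioi j)
      fun k _ => HasFDerivAt.fun_sum (u := Finset.univ) fun i _ =>
        ((hc α j (B.inr (B.toDualLie (b.coord i)))).mul (hc β k (B.inl (b i)))).sub
          ((hc α k (B.inl (b i))).mul (hc β j (B.inr (B.toDualLie (b.coord i))))))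
  refine h.congr_fderiv (ContinuousLinearMap.ext fun v => ?_)
  have h1 := B.mixedTerm_eq b
    (fun j => derivFunctional (hX j) (α ∘ₗ LinearMap.single 𝕜 E j) (v j))
    (fun j => (β ∘ₗ LinearMap.single 𝕜 E j) ∘ₗ LinearMap.proj (e j) ∘ₗ X j)
  have h2 := B.mixedTerm_eq b
    (fun j => derivFunctional (hX j) (β ∘ₗ LinearMap.single 𝕜 E j) (v j))
    (fun j => (α ∘ₗ LinearMap.single 𝕜 E j) ∘ₗ LinearMap.proj (e j) ∘ₗ X j)
  -- The intermediate expression is the product rule, the second mixed term carrying a minus because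
  -- its arguments have been swapped.
  trans ∑ j, fderiv 𝕜 (fun z => P j z (α ∘ₗ LinearMap.single 𝕜 E j)
      (β ∘ₗ LinearMap.single 𝕜 E j)) (e j) (v j) +
    (B.mixedTerm b (fun j => derivFunctional (hX j) (α ∘ₗ LinearMap.single 𝕜 E j) (v j))
      (fun j => (β ∘ₗ LinearMap.single 𝕜 E j) ∘ₗ LinearMap.proj (e j) ∘ₗ X j) -
    B.mixedTerm b (fun j => derivFunctional (hX j) (β ∘ₗ LinearMap.single 𝕜 E j) (v j))
      (fun j => (α ∘ₗ LinearMap.single 𝕜 E j) ∘ₗ LinearMap.proj (e j) ∘ₗ X j))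
  · simp only [LieBialgebra.mixedTerm, ← Finset.sum_sub_distrib, _root_.add_apply,
      _root_.sub_apply, sum_apply, ContinuousLinearMap.comp_apply,
      _root_.smul_apply, ContinuousLinearMap.proj_apply]
    congr 1
    refine Finset.sum_congr rfl fun j _ => Finset.sum_congr rfl fun k _ =>
      Finset.sum_congr rfl fun i _ => ?_
    simp [derivFunctional]
    ring
  · rw [h1, h2, ← Finset.sum_neg_distrib, ← Finset.sum_neg_distrib, ← Finset.sum_sub_distrib,
      ← Finset.sum_add_distrib, sum_apply]
    refine Finset.sum_congr rfl fun j _ => ?_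
    change _ = mixedDifferential (P j) (X j) (e j) _ _ _ _ (v j)
    rw [mixedDifferential_apply]
    simp only [derivFunctional, LinearMap.coe_mk, AddHom.coe_mk]
    ring

lemma fderiv_flatMixedProduct_comp_single {B : LieBialgebra 𝕜 g} (b : Basis ι 𝕜 g)
    {P : ∀ j, E j → Tensor2 𝕜 (E j)} {X : ∀ j, B.Double →ₗ[𝕜] E j → E j} {e : ∀ j, E j}
    (hP : ∀ j α β, DifferentiableAt 𝕜 (fun z => P j z α β) (e j))
    (hX : ∀ j a, DifferentiableAt 𝕜 (X j a) (e j)) (α β : Dual 𝕜 (∀ j, E j)) (j : Fin n) :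
    (fderiv 𝕜 (fun z => flatMixedProduct B b P X z α β) e).toLinearMap ∘ₗ LinearMap.single 𝕜 E j =
      mixedDifferential (P j) (X j) (e j) (α ∘ₗ LinearMap.single 𝕜 E j)
        (β ∘ₗ LinearMap.single 𝕜 E j) (covectorRep B X e α j) (covectorRep B X e β j) := by
  rw [(hasFDerivAt_flatMixedProduct b hP hX α β).fderiv]
  ext v
  simp only [LinearMap.comp_apply, ContinuousLinearMap.coe_coe, sum_apply,
    ContinuousLinearMap.comp_apply, ContinuousLinearMap.proj_apply,
    LinearMap.coe_toContinuousLinearMap', LinearMap.coe_single]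
  rw [Finset.sum_eq_single j (fun k _ hk => by rw [Pi.single_eq_of_ne hk, map_zero]) (by simp),
    Pi.single_eq_same]

/-- A mixed product is a Poisson space of the double of the `n`-uble. -/
theorem isFlatPoissonSpaceAt_flatMixedProduct {B : LieBialgebra 𝕜 g} (b : Basis ι 𝕜 g)
    {P : ∀ j, E j → Tensor2 𝕜 (E j)} {X : ∀ j, B.Double →ₗ[𝕜] E j → E j} {e : ∀ j, E j}
    (h : ∀ j, IsFlatPoissonSpaceAt B.doubleBialgebra (P j) (X j) (e j)) :
    IsFlatPoissonSpaceAt (B.polyubleDouble n) (flatMixedProduct B b P X)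
      (flatProductAction X) e := by
  have hP := fun j => (h j).differentiableAt_tensor
  have hX := fun j => (h j).differentiableAt_action
  have halt := fun j => (h j).alternating
  have hd : ∀ a : Fin n → B.Double, HasFDerivAt (flatProductAction X a)
      (ContinuousLinearMap.pi fun j => (fderiv 𝕜 (X j (a j)) (e j)).comp
        (ContinuousLinearMap.proj j)) e := fun a =>
    hasFDerivAt_pi.2 fun j => hasFDerivAt_comp_apply (hX j (a j))
  refine ⟨fun α β => (hasFDerivAt_flatMixedProduct b hP hX α β).differentiableAt,
    fun a => (hd a).differentiableAt, flatMixedProduct_alternating B b X halt, ?_, ?_, ?_⟩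
  · intro α β γ
    rw [flatSchouten, ← two_mul, mul_eq_zero_iff_left two_ne_zero]
    rw [flatMixedProduct_apply_eq_sum B b P X e α, flatMixedProduct_apply_eq_sum B b P X e β,
      flatMixedProduct_apply_eq_sum B b P X e γ]
    -- The Schouten bracket is now a single sum over the factors, each evaluated by the axioms of
    -- that factor alone. What remains is an identity in `d`.
    simp only [fderiv_flatMixedProduct_comp_single b hP hX, ← Finset.sum_add_distrib,
      (h _).sum_mixedDifferential]
    have key := B.sum_cobracket_mixedRep
      (fun j => (α ∘ₗ LinearMap.single 𝕜 E j) ∘ₗ LinearMap.proj (e j) ∘ₗ X j)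
      (fun j => (β ∘ₗ LinearMap.single 𝕜 E j) ∘ₗ LinearMap.proj (e j) ∘ₗ X j)
      (fun j => (γ ∘ₗ LinearMap.single 𝕜 E j) ∘ₗ LinearMap.proj (e j) ∘ₗ X j)
    simp only [LinearMap.comp_apply, LinearMap.proj_apply] at key ⊢
    exact key
  · intro a a'
    rw [(hd a).fderiv, (hd a').fderiv]
    funext j
    exact (h j).map_lie (a j) (a' j)
  · intro a α β
    -- Pulling a covector back along the product action and then restricting to the j-th copy of `d`
    -- agrees with restricting it to the j-th factor and pulling back along `X j`.
    have hs : ∀ (γ : Dual 𝕜 (∀ j, E j)) (j : Fin n),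
        (γ ∘ₗ LinearMap.proj e ∘ₗ flatProductAction X) ∘ₗ
          LinearMap.single 𝕜 (fun _ => B.Double) j =
        (γ ∘ₗ LinearMap.single 𝕜 E j) ∘ₗ LinearMap.proj (e j) ∘ₗ X j := by
      intro γ j
      ext x
      refine congrArg γ (funext fun k => ?_)
      change X k ((Pi.single j x : Fin n → B.Double) k) (e k) = Pi.single j (X j x (e j)) k
      rcases eq_or_ne k j with rfl | hk
      · simp
      · simp [Pi.single_eq_of_ne hk]
    have hds : ∀ (γ : Dual 𝕜 (∀ j, E j)) (j : Fin n),
        (γ ∘ₗ (fderiv 𝕜 (flatProductAction X a) e).toLinearMap) ∘ₗ LinearMap.single 𝕜 E j =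
        (γ ∘ₗ LinearMap.single 𝕜 E j) ∘ₗ (fderiv 𝕜 (X j (a j)) (e j)).toLinearMap := by
      intro γ j
      rw [(hd a).fderiv]
      ext x
      refine congrArg γ (funext fun k => ?_)
      change fderiv 𝕜 (X k (a k)) (e k) (Pi.single j x k) =
        Pi.single j (fderiv 𝕜 (X j (a j)) (e j) x) k
      rcases eq_or_ne k j with rfl | hk
      · simp
      · simp [Pi.single_eq_of_ne hk]
    -- The swap moves the covector composed with the differential of the action to the second slot,
    -- so that `covectorRep` is only taken of α and β themselves.
    rw [B.polyubleDouble_cobracket_eq, flatLieDeriv,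
      flatMixedProduct_swap B b X halt (α ∘ₗ _) β, sub_neg_eq_add,
      flatMixedProduct_apply_eq_sum, flatMixedProduct_apply_eq_sum,
      (hasFDerivAt_flatMixedProduct b hP hX α β).fderiv, sum_apply,
      ← Finset.sum_add_distrib, ← Finset.sum_sub_distrib]
    refine Finset.sum_congr rfl fun j _ => ?_
    rw [hds, hds]
    simp only [hs]
    exact (h j).lieDeriv_mixedDifferential _ _ _ _ _

end Product

end Flat

/-! ### Reading the axioms on a manifold in charts, and restricting actions of the double. -/

section Fields

open scoped Topology

variable {𝕜 : Type*} [RCLike 𝕜]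
  {E : Type*} [NormedAddCommGroup E] [NormedSpace 𝕜 E] {H : Type*} [TopologicalSpace H]
  {I : ModelWithCorners 𝕜 E H} {Y : Type*} [TopologicalSpace Y] [ChartedSpace H Y]

lemma chartVectorField_extChartAt (X : ∀ y : Y, TangentSpace I y) {y₀ y : Y}
    (hy : y ∈ (extChartAt I y₀).source) : chartVectorField I X y₀ (extChartAt I y₀ y) =
      mfderiv I 𝓘(𝕜, E) (extChartAt I y₀) y (X y) := by
  -- The base point occurs in the types of the tangent vectors, so the identity `left_inv` is
  -- applied through a free point z.
  have h : ∀ z, z = y → (mfderiv I 𝓘(𝕜, E) (extChartAt I y₀) z (X z) : E) =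
      mfderiv I 𝓘(𝕜, E) (extChartAt I y₀) y (X y) := by
    rintro _ rfl; rfl
  exact h _ ((extChartAt I y₀).left_inv hy)

lemma chartTensorField_extChartAt (P : ∀ y : Y, Tensor2 𝕜 (TangentSpace I y)) {y₀ y : Y}
    (hy : y ∈ (extChartAt I y₀).source) : chartTensorField I P y₀ (extChartAt I y₀ y) =
      Tensor2.map (mfderiv I 𝓘(𝕜, E) (extChartAt I y₀) y).toLinearMap (P y) := by
  have h : ∀ z, z = y →
      (Tensor2.map (mfderiv I 𝓘(𝕜, E) (extChartAt I y₀) z).toLinearMap (P z) : Tensor2 𝕜 E) =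
      Tensor2.map (mfderiv I 𝓘(𝕜, E) (extChartAt I y₀) y).toLinearMap (P y) := by
    rintro _ rfl; rfl
  exact h _ ((extChartAt I y₀).left_inv hy)

lemma chartVectorField_add (X X' : ∀ y : Y, TangentSpace I y) (y₀ : Y) :
    chartVectorField I (X + X') y₀ = chartVectorField I X y₀ + chartVectorField I X' y₀ :=
  funext fun _ => map_add (mfderiv I 𝓘(𝕜, E) (extChartAt I y₀) _) _ _

lemma chartVectorField_smul (c : 𝕜) (X : ∀ y : Y, TangentSpace I y) (y₀ : Y) :
    chartVectorField I (c • X) y₀ = c • chartVectorField I X y₀ :=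
  funext fun _ => map_smul (mfderiv I 𝓘(𝕜, E) (extChartAt I y₀) _) _ _

variable (I) in
/-- The expression of an action in the chart at `y₀`. -/
def chartAction {d : Type*} [AddCommGroup d] [Module 𝕜 d]
    (σ : d →ₗ[𝕜] ∀ y : Y, TangentSpace I y) (y₀ : Y) : d →ₗ[𝕜] E → E where
  toFun a := chartVectorField I (σ a) y₀
  map_add' a a' := by rw [map_add, chartVectorField_add]
  map_smul' c a := by rw [map_smul, chartVectorField_smul, RingHom.id_apply]

variable [IsManifold I ∞ Y]

/-- The tangent space at y is the model space seen through the preferred chart at y, so the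
differential of that chart at y is the identity. -/
lemma chartVectorField_center (X : ∀ y : Y, TangentSpace I y) (y : Y) :
    chartVectorField I X y (extChartAt I y y) = X y := by
  have : IsManifold I 1 Y := .of_le (n := ∞) (by simp)
  rw [chartVectorField_extChartAt X (mem_extChartAt_source y), mfderiv_extChartAt_self]
  rfl

lemma chartTensorField_center (P : ∀ y : Y, Tensor2 𝕜 (TangentSpace I y)) (y : Y) :
    chartTensorField I P y (extChartAt I y y) = P y := by
  have : IsManifold I 1 Y := .of_le (n := ∞) (by simp)
  rw [chartTensorField_extChartAt P (mem_extChartAt_source y), mfderiv_extChartAt_self]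
  rfl

lemma chartCovector_eq (y : Y) (α : Dual 𝕜 (TangentSpace I y)) : chartCovector I y α = α := by
  have : IsManifold I 1 Y := .of_le (n := ∞) (by simp)
  rw [chartCovector, mfderiv_extChartAt_self]
  change α ∘ₗ (ContinuousLinearMap.inverse (ContinuousLinearMap.id 𝕜 E)).toLinearMap = α
  rw [ContinuousLinearMap.inverse_id]
  rfl

lemma schouten_eq_flatSchouten (P Q : ∀ y : Y, Tensor2 𝕜 (TangentSpace I y)) (y : Y)
    (α β γ : Dual 𝕜 E) : schouten I P Q y α β γ =
      flatSchouten (chartTensorField I P y) (chartTensorField I Q y) (extChartAt I y y) α β γ := by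
  have h : ∀ α : Dual 𝕜 E, chartCovector I y α = α := chartCovector_eq y
  change flatSchouten _ _ _ (chartCovector I y α) (chartCovector I y β) (chartCovector I y γ) = _
  rw [h, h, h]

lemma lieDeriv_eq_flatLieDeriv (X : ∀ y : Y, TangentSpace I y)
    (P : ∀ y : Y, Tensor2 𝕜 (TangentSpace I y)) (y : Y)
    (α β : Dual 𝕜 E) : lieDeriv I X P y α β =
      flatLieDeriv (chartVectorField I X y) (chartTensorField I P y) (extChartAt I y y) α β := by
  have h : ∀ α : Dual 𝕜 E, chartCovector I y α = α := chartCovector_eq y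
  change flatLieDeriv _ _ _ (chartCovector I y α) (chartCovector I y β) = _
  rw [h, h]

variable [I.Boundaryless]

/-- The bracket is defined by pulling back along the inverse chart, while `chartVectorField` pushes
forward along the chart. The two differentials are mutually inverse on the chart target, which is a
neighbourhood of the centre since there is no boundary. -/
lemma mlieBracket_eq_chart (V W : ∀ y : Y, TangentSpace I y) (y : Y) :
    VectorField.mlieBracket I V W y =
      fderiv 𝕜 (chartVectorField I W y) (extChartAt I y y) (V y) -
        fderiv 𝕜 (chartVectorField I V y) (extChartAt I y y) (W y) := by
  have : IsManifold I 1 Y := .of_le (n := ∞) (by simp)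
  have key : ∀ V : ∀ y : Y, TangentSpace I y,
      (VectorField.mpullbackWithin 𝓘(𝕜, E) I (extChartAt I y).symm V (Set.range I) : E → E)
        =ᶠ[𝓝 (extChartAt I y y)] chartVectorField I V y := by
    intro V
    filter_upwards [extChartAt_target_mem_nhds y] with z hz
    rw [VectorField.mpullbackWithin_apply, chartVectorField]
    rw [ContinuousLinearMap.inverse_eq
      (mfderivWithin_extChartAt_symm_comp_mfderiv_extChartAt hz)
      (mfderiv_extChartAt_comp_mfderivWithin_extChartAt_symm hz)]
    rfl
  rw [← VectorField.mlieBracketWithin_univ, VectorField.mlieBracketWithin_apply,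
    mfderiv_extChartAt_self]
  change (ContinuousLinearMap.inverse (ContinuousLinearMap.id 𝕜 E)) _ = _
  rw [ContinuousLinearMap.inverse_id, I.range_eq_univ, Set.preimage_univ, Set.inter_self]
  have h := Filter.EventuallyEq.lieBracketWithin_vectorField_eq_nhds (𝕜 := 𝕜) (s := Set.univ)
    (key V) (key W)
  rw [I.range_eq_univ] at h
  refine Eq.trans h ?_
  rw [VectorField.lieBracketWithin_univ, VectorField.lieBracket, chartVectorField_center,
    chartVectorField_center]

omit [I.Boundaryless] in
-- The trivialization of the tangent bundle at y₀ is the differential of the chart at y₀, so both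
-- sides express smoothness of the same coordinate functions.
lemma contMDiff_iff_chartVectorField (X : ∀ y : Y, TangentSpace I y) :
    ContMDiff I I.tangent ∞ (fun y => (⟨y, X y⟩ : TangentBundle I Y)) ↔
      ∀ y₀, ContDiffOn 𝕜 ∞ (chartVectorField I X y₀) (extChartAt I y₀).target := by
  have : IsManifold I 1 Y := .of_le (n := ∞) (by simp)
  have key : ∀ y₀ : Y,
      ContMDiffOn I I.tangent ∞ (fun y => (⟨y, X y⟩ : TangentBundle I Y)) (chartAt H y₀).source ↔
      ContMDiffOn I 𝓘(𝕜, E) ∞ (fun y => (mfderiv I 𝓘(𝕜, E) (extChartAt I y₀) y (X y) : E))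
        (chartAt H y₀).source := by
    intro y₀
    have h := (trivializationAt E (TangentSpace I : Y → Type _) y₀).contMDiffOn_section_baseSet_iff
      (n := ∞) (IB := I) (s := X)
    rw [TangentBundle.trivializationAt_baseSet] at h
    refine h.trans (contMDiffOn_congr fun y hy => ?_)
    rw [← TangentBundle.continuousLinearMapAt_trivializationAt hy]
    exact (Bundle.Trivialization.continuousLinearMapAt_apply_of_mem 𝕜 _ (by simpa using hy) _).symm
  constructor
  · intro h y₀
    rw [← contMDiffOn_iff_contDiffOn]
    refine ((key y₀).1 h.contMDiffOn).comp (contMDiffOn_extChartAt_symm y₀) fun e he => ?_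
    simpa using (extChartAt I y₀).map_target he
  · intro h y
    refine ((key y).2 ?_).contMDiffAt ((chartAt H y).open_source.mem_nhds (mem_chart_source H y))
    refine ((contMDiffOn_iff_contDiffOn.2 (h y)).comp contMDiffOn_extChartAt fun z hz => ?_).congr
      fun z hz => ?_
    · exact (extChartAt I y).map_source (by simpa using hz)
    · exact (chartVectorField_extChartAt X (by simpa using hz)).symm

variable {g : Type*} [LieRing g] [LieAlgebra 𝕜 g]

/-- The conditions on a left Poisson space can be checked at the centres of the charts. -/
lemma isLeftPoissonSpace_iff (B : LieBialgebra 𝕜 g) (π : ∀ y : Y, Tensor2 𝕜 (TangentSpace I y))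
    (σ : g →ₗ[𝕜] ∀ y : Y, TangentSpace I y) : IsLeftPoissonSpace I B π σ ↔
      (∀ (y₀ : Y) (α β : Dual 𝕜 E),
        ContDiffOn 𝕜 ∞ (fun e => chartTensorField I π y₀ e α β) (extChartAt I y₀).target) ∧
      (∀ (y₀ : Y) (a : g), ContDiffOn 𝕜 ∞ (chartAction I σ y₀ a) (extChartAt I y₀).target) ∧
      ∀ y : Y, IsFlatPoissonSpaceAt B (chartTensorField I π y) (chartAction I σ y)
        (extChartAt I y y) := by
  -- At the centre of the chart the action and its coordinate expression coincide, hence so do the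
  -- functionals fed to the co-bracket.
  have hcov : ∀ (y : Y) (α : Dual 𝕜 E), α ∘ₗ LinearMap.proj (extChartAt I y y) ∘ₗ
      chartAction I σ y = α ∘ₗ (LinearMap.proj y ∘ₗ σ : g →ₗ[𝕜] TangentSpace I y) := by
    intro y α
    ext a
    exact congrArg α (chartVectorField_center (σ a) y)
  constructor
  · intro h
    have h2 : ∀ (y₀ : Y) (a : g),
        ContDiffOn 𝕜 ∞ (chartAction I σ y₀ a) (extChartAt I y₀).target :=
      fun y₀ a => (contMDiff_iff_chartVectorField _).1 (h.smooth a) y₀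
    refine ⟨h.isPoisson.smooth, h2, fun y => ⟨fun α β => ?_, fun a => ?_, ?_, ?_, ?_, ?_⟩⟩
    · exact ((h.isPoisson.smooth y α β).contDiffAt (extChartAt_target_mem_nhds y)).differentiableAt
        (by simp)
    · exact ((h2 y a).contDiffAt (extChartAt_target_mem_nhds y)).differentiableAt (by simp)
    · rw [chartTensorField_center]
      exact h.isPoisson.alternating y
    · intro α β γ
      rw [← schouten_eq_flatSchouten]
      exact h.isPoisson.schouten_self y α β γ
    · intro a b
      change chartVectorField I (σ ⁅a, b⁆) y _ = -(fderiv 𝕜 (chartVectorField I (σ b) y) _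
        (chartVectorField I (σ a) y _) - fderiv 𝕜 (chartVectorField I (σ a) y) _
        (chartVectorField I (σ b) y _))
      rw [chartVectorField_center, chartVectorField_center, chartVectorField_center, h.map_lie,
        mlieBracket_eq_chart]
      rfl
    · intro a α β
      rw [hcov, hcov]
      exact (lieDeriv_eq_flatLieDeriv (σ a) π y α β).symm.trans (h.compat a y α β)
  · rintro ⟨h1, h2, h⟩
    refine ⟨⟨fun y => ?_, h1, fun y α β γ => ?_⟩, fun a => ?_, fun a b y => ?_,
      fun a y α β => ?_⟩
    · rw [← chartTensorField_center π y]
      exact (h y).alternating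
    · exact (schouten_eq_flatSchouten π π y α β γ).trans ((h y).schouten_self _ _ _)
    · exact (contMDiff_iff_chartVectorField _).2 fun y₀ => h2 y₀ a
    · have h3 := (h y).map_lie a b
      change chartVectorField I (σ ⁅a, b⁆) y _ = -(fderiv 𝕜 (chartVectorField I (σ b) y) _
        (chartVectorField I (σ a) y _) - fderiv 𝕜 (chartVectorField I (σ a) y) _
        (chartVectorField I (σ b) y _)) at h3
      rw [chartVectorField_center, chartVectorField_center, chartVectorField_center] at h3
      rw [mlieBracket_eq_chart]
      exact h3
    · have h3 := (h y).compat a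
      simp only [hcov] at h3
      exact (lieDeriv_eq_flatLieDeriv (σ a) π y α β).trans (h3 α β)

variable [FiniteDimensional 𝕜 g] {B : LieBialgebra 𝕜 g}
  {π : ∀ y : Y, Tensor2 𝕜 (TangentSpace I y)} {σ : B.Double →ₗ[𝕜] ∀ y : Y, TangentSpace I y}

omit [I.Boundaryless] in
/-- A Poisson space of the double is a left Poisson space of `g`. -/
theorem IsLeftPoissonSpace.restrictLeft (h : IsLeftPoissonSpace I B.doubleBialgebra π σ) :
    IsLeftPoissonSpace I B π (restrictLeft I B σ) where
  isPoisson := h.isPoisson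
  smooth x := h.smooth (B.inl x)
  map_lie x x' y := by
    change σ (B.inl ⁅x, x'⁆) y = _
    rw [B.inl_lie, h.map_lie]
    rfl
  compat x y α β := by
    exact (h.compat (B.inl x) y α β).trans (B.doubleBialgebra_cobracket_inl x
      (α ∘ₗ LinearMap.proj y ∘ₗ σ) (β ∘ₗ LinearMap.proj y ∘ₗ σ))

omit [I.Boundaryless] in
/-- A Poisson space of the double is a right Poisson space of `g*`. -/
theorem IsLeftPoissonSpace.restrictRight (h : IsLeftPoissonSpace I B.doubleBialgebra π σ) :
    IsRightPoissonSpace I B.dual π (restrictRight I B σ) := by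
  have hr : ∀ ξ, PoissonLie.restrictRight I B σ ξ = σ (B.inr (-ξ)) := fun ξ => by
    rw [map_neg, map_neg]; rfl
  refine ⟨h.isPoisson, fun ξ => ?_, fun ξ ξ' y => ?_, fun ξ y α β => ?_⟩
  · rw [hr]
    exact h.smooth _
  · have h1 : B.inr (-⁅ξ, ξ'⁆) = -⁅B.inr (-ξ), B.inr (-ξ')⁆ := by
      rw [← B.inr_lie, neg_lie, lie_neg, neg_neg, map_neg]
    rw [hr, hr, hr, h1, map_neg, Pi.neg_apply, h.map_lie, neg_neg]
  · rw [hr]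
    refine (h.compat _ y α β).trans ?_
    have h1 := B.doubleBialgebra_cobracket_inr (-ξ)
      (α ∘ₗ LinearMap.proj y ∘ₗ σ) (β ∘ₗ LinearMap.proj y ∘ₗ σ)
    have h2 : ∀ α : Dual 𝕜 (TangentSpace I y),
        α ∘ₗ LinearMap.proj y ∘ₗ PoissonLie.restrictRight I B σ =
          -((α ∘ₗ LinearMap.proj y ∘ₗ σ) ∘ₗ B.inr) := fun α =>
      LinearMap.ext fun ξ => map_neg α _
    change _ = B.dual.cobracket ξ (α ∘ₗ LinearMap.proj y ∘ₗ PoissonLie.restrictRight I B σ)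
      (β ∘ₗ LinearMap.proj y ∘ₗ PoissonLie.restrictRight I B σ)
    rw [h2, h2]
    -- The minus sign of `doubleBialgebra_cobracket_inr` cancels against -ξ, and the signs on the
    -- two functionals cancel each other.
    refine h1.trans ?_
    simp only [map_neg, LinearMap.neg_apply, neg_neg]

end Fields

section Congr

open scoped Topology

variable {𝕜 : Type*} [RCLike 𝕜] {g : Type*} [LieRing g] [LieAlgebra 𝕜 g]
  {E : Type*} [NormedAddCommGroup E] [NormedSpace 𝕜 E]

/-- All conditions involve only values and first derivatives at e. This is needed because the
coordinate formulas for a product of manifolds hold only on the chart target. -/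
lemma IsFlatPoissonSpaceAt.congr {B : LieBialgebra 𝕜 g} {P P' : E → Tensor2 𝕜 E}
    {X X' : g →ₗ[𝕜] E → E} {e : E} (h : IsFlatPoissonSpaceAt B P X e) (hP : P' =ᶠ[𝓝 e] P)
    (hX : ∀ a, X' a =ᶠ[𝓝 e] X a) : IsFlatPoissonSpaceAt B P' X' e := by
  have hP' : ∀ α β, (fun z => P' z α β) =ᶠ[𝓝 e] fun z => P z α β := fun α β =>
    hP.mono fun z hz => by simp only [hz]
  have hX0 : (LinearMap.proj e ∘ₗ X' : g →ₗ[𝕜] E) = LinearMap.proj e ∘ₗ X :=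
    LinearMap.ext fun a => (hX a).eq_of_nhds
  refine ⟨fun α β => (h.differentiableAt_tensor α β).congr_of_eventuallyEq (hP' α β),
    fun a => (h.differentiableAt_action a).congr_of_eventuallyEq (hX a), fun α => ?_,
    fun α β γ => ?_, fun a b => ?_, fun a α β => ?_⟩
  · rw [hP.eq_of_nhds]
    exact h.alternating α
  · rw [← h.schouten_self α β γ]
    simp only [flatSchouten, (hP' _ _).fderiv_eq, hP.eq_of_nhds]
  · simp only [(hX _).fderiv_eq, (hX _).eq_of_nhds]
    exact h.map_lie a b
  · rw [hX0, ← h.compat]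
    simp only [flatLieDeriv, (hP' _ _).fderiv_eq, (hX _).fderiv_eq, (hX _).eq_of_nhds,
      hP.eq_of_nhds]

end Congr

/-! ### Finite products of manifolds: product charts, mixed products and projections. -/

section ManyFold

open scoped Topology

variable {𝕜 : Type*} [RCLike 𝕜]
  {n : ℕ} {E : Fin n → Type*} [∀ j, NormedAddCommGroup (E j)] [∀ j, NormedSpace 𝕜 (E j)]
  {H : Fin n → Type*} [∀ j, TopologicalSpace (H j)] {I : ∀ j, ModelWithCorners 𝕜 (E j) (H j)}
  {Y : Fin n → Type*} [∀ j, TopologicalSpace (Y j)] [∀ j, ChartedSpace (H j) (Y j)]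

instance boundaryless_pi [∀ j, (I j).Boundaryless] : (ModelWithCorners.pi I).Boundaryless where
  range_eq_univ := by
    rw [Set.range_eq_univ]
    intro z
    choose w hw using fun j => (I j).range_eq_univ ▸ Set.mem_univ (z j)
    exact ⟨w, funext hw⟩

lemma extChartAt_pi_apply (y z : ∀ j, Y j) (j : Fin n) :
    extChartAt (ModelWithCorners.pi I) y z j = extChartAt (I j) (y j) (z j) := rfl

lemma mem_extChartAt_pi_source {y z : ∀ j, Y j} :
    z ∈ (extChartAt (ModelWithCorners.pi I) y).source ↔
      ∀ j, z j ∈ (extChartAt (I j) (y j)).source := by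
  simp only [extChartAt_source]
  change z ∈ Set.pi Set.univ _ ↔ _
  simp

lemma mem_extChartAt_pi_target {y : ∀ j, Y j} {e : ∀ j, E j}
    (he : e ∈ (extChartAt (ModelWithCorners.pi I) y).target) (j : Fin n) :
    e j ∈ (extChartAt (I j) (y j)).target := by
  have h := mem_extChartAt_pi_source.1 ((extChartAt (ModelWithCorners.pi I) y).map_target he) j
  have h1 := congrFun ((extChartAt (ModelWithCorners.pi I) y).right_inv he) j
  rw [extChartAt_pi_apply] at h1
  rw [← h1]
  exact (extChartAt (I j) (y j)).map_source h

lemma hasMFDerivAt_apply [∀ j, (I j).Boundaryless] (y : ∀ j, Y j) (j : Fin n) :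
    HasMFDerivAt (ModelWithCorners.pi I) (I j) (fun z : ∀ j, Y j => z j) y
      (ContinuousLinearMap.proj (R := 𝕜) (φ := E) j) := by
  refine ⟨(continuous_apply j).continuousAt, ?_⟩
  refine HasFDerivAt.hasFDerivWithinAt ?_
  refine (ContinuousLinearMap.proj (R := 𝕜) (φ := E) j).hasFDerivAt.congr_of_eventuallyEq ?_
  filter_upwards [extChartAt_target_mem_nhds (I := ModelWithCorners.pi I) y] with e he
  exact (extChartAt (I j) (y j)).right_inv (mem_extChartAt_pi_target he j)

variable [∀ j, IsManifold (I j) ∞ (Y j)] [∀ j, (I j).Boundaryless]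

lemma hasMFDerivAt_extChartAt_pi {y₀ y : ∀ j, Y j}
    (hy : y ∈ (extChartAt (ModelWithCorners.pi I) y₀).source) :
    HasMFDerivAt (ModelWithCorners.pi I) 𝓘(𝕜, ∀ j, E j) (extChartAt (ModelWithCorners.pi I) y₀) y
      (ContinuousLinearMap.pi fun j =>
        (show E j →L[𝕜] E j from mfderiv (I j) 𝓘(𝕜, E j) (extChartAt (I j) (y₀ j)) (y j)).comp
          (ContinuousLinearMap.proj (R := 𝕜) (φ := E) j)) := by
  have : ∀ j, IsManifold (I j) 1 (Y j) := fun j => .of_le (n := ∞) (by simp)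
  refine ⟨continuousAt_extChartAt' hy, ?_⟩
  refine hasFDerivWithinAt_pi.2 fun j => ?_
  have h1 : HasMFDerivAt (ModelWithCorners.pi I) 𝓘(𝕜, E j)
      (extChartAt (I j) (y₀ j) ∘ fun z : ∀ j, Y j => z j) y _ :=
    (mdifferentiableAt_extChartAt (I := I j) (by
      simpa using mem_extChartAt_pi_source.1 hy j)).hasMFDerivAt.comp y (hasMFDerivAt_apply y j)
  exact h1.2

lemma mfderiv_extChartAt_pi_apply {y₀ y : ∀ j, Y j}
    (hy : y ∈ (extChartAt (ModelWithCorners.pi I) y₀).source) (v : ∀ j, E j) :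
    (mfderiv (ModelWithCorners.pi I) 𝓘(𝕜, ∀ j, E j) (extChartAt (ModelWithCorners.pi I) y₀) y v :
      ∀ j, E j) =
      fun j => (mfderiv (I j) 𝓘(𝕜, E j) (extChartAt (I j) (y₀ j)) (y j) (v j) : E j) := by
  rw [(hasMFDerivAt_extChartAt_pi hy).mfderiv]
  rfl

/-- The differential of a product chart is block diagonal; this is what makes the mixed product
compatible with charts. -/
lemma mfderiv_extChartAt_pi_single {y₀ y : ∀ j, Y j}
    (hy : y ∈ (extChartAt (ModelWithCorners.pi I) y₀).source) (j : Fin n) (v : E j) :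
    (mfderiv (ModelWithCorners.pi I) 𝓘(𝕜, ∀ j, E j) (extChartAt (ModelWithCorners.pi I) y₀) y
      (LinearMap.single 𝕜 E j v) : ∀ j, E j) =
      LinearMap.single 𝕜 E j
        (mfderiv (I j) 𝓘(𝕜, E j) (extChartAt (I j) (y₀ j)) (y j) v : E j) := by
  have h : ∀ D : ∀ k, E k →ₗ[𝕜] E k, (fun k => D k (LinearMap.single 𝕜 E j v k)) =
      LinearMap.single 𝕜 E j (D j v) := by
    intro D
    funext k
    rcases eq_or_ne k j with rfl | hk
    · simp
    · simp [Pi.single_eq_of_ne hk]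
  exact (mfderiv_extChartAt_pi_apply hy _).trans (h fun k =>
    (mfderiv (I k) 𝓘(𝕜, E k) (extChartAt (I k) (y₀ k)) (y k)).toLinearMap)

lemma chartAction_productAction {d : Type*} [AddCommGroup d] [Module 𝕜 d]
    (σ : ∀ j, d →ₗ[𝕜] ∀ y : Y j, TangentSpace (I j) y) (a : Fin n → d) {y₀ : ∀ j, Y j}
    {e : ∀ j, E j} (he : e ∈ (extChartAt (ModelWithCorners.pi I) y₀).target) :
    chartAction (ModelWithCorners.pi I) (productAction I σ) y₀ a e =
      flatProductAction (fun j => chartAction (I j) (σ j) (y₀ j)) a e := by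
  have hs := (extChartAt (ModelWithCorners.pi I) y₀).map_target he
  refine (mfderiv_extChartAt_pi_apply hs _).trans (funext fun j => ?_)
  have h : ∀ v : ∀ k, E k, (∑ k, LinearMap.single 𝕜 E k (v k)) j = v j := fun v => by
    simp only [LinearMap.coe_single, Finset.univ_sum_single]
  exact congrArg (mfderiv (I j) 𝓘(𝕜, E j) (extChartAt (I j) (y₀ j))
    ((extChartAt (I j) (y₀ j)).symm (e j)))
    (h fun k => σ k (a k) ((extChartAt (I k) (y₀ k)).symm (e k)))

lemma Tensor2.map_sub {V W : Type*} [AddCommGroup V] [Module 𝕜 V] [AddCommGroup W] [Module 𝕜 W]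
    (f : V →ₗ[𝕜] W) (P Q : Tensor2 𝕜 V) :
    Tensor2.map f (P - Q) = Tensor2.map f P - Tensor2.map f Q := rfl

lemma Tensor2.map_sum {V W : Type*} [AddCommGroup V] [Module 𝕜 V] [AddCommGroup W] [Module 𝕜 W]
    (f : V →ₗ[𝕜] W) {κ : Type*} (s : Finset κ) (P : κ → Tensor2 𝕜 V) :
    Tensor2.map f (∑ i ∈ s, P i) = ∑ i ∈ s, Tensor2.map f (P i) := by
  ext α β
  simp [Tensor2.map, LinearMap.sum_apply]

lemma Tensor2.map_map {V W Z : Type*} [AddCommGroup V] [Module 𝕜 V] [AddCommGroup W] [Module 𝕜 W]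
    [AddCommGroup Z] [Module 𝕜 Z] (f : V →ₗ[𝕜] W) (f' : W →ₗ[𝕜] Z) (P : Tensor2 𝕜 V) :
    Tensor2.map f' (Tensor2.map f P) = Tensor2.map (f' ∘ₗ f) P := rfl

lemma Tensor2.map_wedge {V W : Type*} [AddCommGroup V] [Module 𝕜 V] [AddCommGroup W] [Module 𝕜 W]
    (f : V →ₗ[𝕜] W) (v w : V) : Tensor2.map f (wedge 𝕜 v w) = wedge 𝕜 (f v) (f w) := rfl

variable {g : Type*} [LieRing g] [LieAlgebra 𝕜 g] {ι : Type*} [Fintype ι]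

lemma chartTensorField_polyMixedProduct (B : LieBialgebra 𝕜 g) (b : Basis ι 𝕜 g)
    (π : ∀ j, ∀ y : Y j, Tensor2 𝕜 (TangentSpace (I j) y))
    (σ : ∀ j, B.Double →ₗ[𝕜] ∀ y : Y j, TangentSpace (I j) y) {y₀ : ∀ j, Y j} {e : ∀ j, E j}
    (he : e ∈ (extChartAt (ModelWithCorners.pi I) y₀).target) :
    chartTensorField (ModelWithCorners.pi I) (polyMixedProduct I B b π σ) y₀ e =
      flatMixedProduct B b (fun j => chartTensorField (I j) (π j) (y₀ j))
        (fun j => chartAction (I j) (σ j) (y₀ j)) e := by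
  have hs := (extChartAt (ModelWithCorners.pi I) y₀).map_target he
  have key := fun j => mfderiv_extChartAt_pi_single hs j
  -- Naming the data with values in the model spaces erases the base points from the types. The
  -- claim becomes naturality of `Tensor2.map` and `wedge` under a block-diagonal map.
  let D : (∀ j, E j) →ₗ[𝕜] (∀ j, E j) :=
    (mfderiv (ModelWithCorners.pi I) 𝓘(𝕜, ∀ j, E j) (extChartAt (ModelWithCorners.pi I) y₀)
      ((extChartAt (ModelWithCorners.pi I) y₀).symm e)).toLinearMap
  let D' : ∀ j, E j →ₗ[𝕜] E j := fun j =>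
    (mfderiv (I j) 𝓘(𝕜, E j) (extChartAt (I j) (y₀ j))
      ((extChartAt (I j) (y₀ j)).symm (e j))).toLinearMap
  let P : ∀ j, Tensor2 𝕜 (E j) := fun j => π j ((extChartAt (I j) (y₀ j)).symm (e j))
  let X : ∀ j, B.Double → E j := fun j a => σ j a ((extChartAt (I j) (y₀ j)).symm (e j))
  have hD : ∀ j (v : E j), D (LinearMap.single 𝕜 E j v) = LinearMap.single 𝕜 E j (D' j v) := key
  have hD' : ∀ j, D ∘ₗ LinearMap.single 𝕜 E j = LinearMap.single 𝕜 E j ∘ₗ D' j := fun j =>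
    LinearMap.ext (hD j)
  change Tensor2.map D (∑ j, Tensor2.map (LinearMap.single 𝕜 E j) (P j) -
    ∑ j, ∑ k ∈ Finset.Ioi j, ∑ i,
      wedge 𝕜 (LinearMap.single 𝕜 E j (-X j (B.inr (B.toDualLie (b.coord i)))))
        (LinearMap.single 𝕜 E k (X k (B.inl (b i))))) =
    ∑ j, Tensor2.map (LinearMap.single 𝕜 E j) (Tensor2.map (D' j) (P j)) -
    ∑ j, ∑ k ∈ Finset.Ioi j, ∑ i,
      wedge 𝕜 (LinearMap.single 𝕜 E j (-D' j (X j (B.inr (B.toDualLie (b.coord i))))))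
        (LinearMap.single 𝕜 E k (D' k (X k (B.inl (b i)))))
  simp only [Tensor2.map_sub, Tensor2.map_sum, Tensor2.map_map, Tensor2.map_wedge, hD, hD',
    map_neg]

variable [FiniteDimensional 𝕜 g] [∀ j, FiniteDimensional 𝕜 (E j)]

/-- A mixed product of Poisson spaces of the double is a Poisson space of the double of the
`n`-uble. -/
theorem isLeftPoissonSpace_polyMixedProduct (B : LieBialgebra 𝕜 g) (b : Basis ι 𝕜 g)
    {π : ∀ j, ∀ y : Y j, Tensor2 𝕜 (TangentSpace (I j) y)}
    {σ : ∀ j, B.Double →ₗ[𝕜] ∀ y : Y j, TangentSpace (I j) y}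
    (h : ∀ j, IsLeftPoissonSpace (I j) B.doubleBialgebra (π j) (σ j)) :
    IsLeftPoissonSpace (ModelWithCorners.pi I) (B.polyubleDouble n)
      (polyMixedProduct I B b π σ) (productAction I σ) := by
  have h' := fun j => (isLeftPoissonSpace_iff _ _ _).1 (h j)
  have hproj : ∀ (y₀ : ∀ j, Y j) (j : Fin n), Set.MapsTo (fun e : ∀ j, E j => e j)
      (extChartAt (ModelWithCorners.pi I) y₀).target (extChartAt (I j) (y₀ j)).target :=
    fun y₀ j e he => mem_extChartAt_pi_target he j
  have hX : ∀ (y₀ : ∀ j, Y j) (j : Fin n) (a : B.Double),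
      ContDiffOn 𝕜 ∞ (fun e : ∀ j, E j => chartAction (I j) (σ j) (y₀ j) a (e j))
        (extChartAt (ModelWithCorners.pi I) y₀).target := fun y₀ j a =>
    ((h' j).2.1 (y₀ j) a).comp (ContinuousLinearMap.proj (R := 𝕜) (φ := E) j).contDiff.contDiffOn (hproj y₀ j)
  have hXα : ∀ (y₀ : ∀ j, Y j) (j : Fin n) (a : B.Double) (α : Dual 𝕜 (E j)),
      ContDiffOn 𝕜 ∞ (fun e : ∀ j, E j => α (chartAction (I j) (σ j) (y₀ j) a (e j)))
        (extChartAt (ModelWithCorners.pi I) y₀).target := fun y₀ j a α =>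
    α.toContinuousLinearMap.contDiff.comp_contDiffOn (hX y₀ j a)
  refine (isLeftPoissonSpace_iff _ _ _).2 ⟨fun y₀ α β => ?_, fun y₀ a => ?_, fun y => ?_⟩
  · refine ContDiffOn.congr (f := fun e => flatMixedProduct B b
      (fun j => chartTensorField (I j) (π j) (y₀ j)) (fun j => chartAction (I j) (σ j) (y₀ j))
      e α β) ?_ fun e he => by rw [chartTensorField_polyMixedProduct B b π σ he]
    simp only [flatMixedProduct_apply, LieBialgebra.mixedTerm]
    refine ContDiffOn.add (ContDiffOn.sum fun j _ => ?_)
      (ContDiffOn.sum fun j _ => ContDiffOn.sum fun k _ => ContDiffOn.sum fun i _ => ?_)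
    · exact ((h' j).1 (y₀ j) (α ∘ₗ LinearMap.single 𝕜 E j) (β ∘ₗ LinearMap.single 𝕜 E j)).comp
        (ContinuousLinearMap.proj (R := 𝕜) (φ := E) j).contDiff.contDiffOn (hproj y₀ j)
    · have hγ := fun (γ : Dual 𝕜 (∀ j, E j)) (l : Fin n) (a : B.Double) =>
        hXα y₀ l a (γ ∘ₗ LinearMap.single 𝕜 E l)
      exact ((hγ α j (B.inr (B.toDualLie (b.coord i)))).mul (hγ β k (B.inl (b i)))).sub
        ((hγ α k (B.inl (b i))).mul (hγ β j (B.inr (B.toDualLie (b.coord i)))))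
  · refine ContDiffOn.congr ?_ fun e he => chartAction_productAction σ a he
    exact contDiffOn_pi.2 fun j => hX y₀ j (a j)
  · have ht := extChartAt_target_mem_nhds (I := ModelWithCorners.pi I) y
    exact (isFlatPoissonSpaceAt_flatMixedProduct b
      (P := fun j => chartTensorField (I j) (π j) (y j))
      (X := fun j => chartAction (I j) (σ j) (y j)) (e := extChartAt (ModelWithCorners.pi I) y y)
      fun j => (h' j).2.2 (y j)).congr
        (Filter.mem_of_superset ht fun e he => chartTensorField_polyMixedProduct B b π σ he)
        fun a => Filter.mem_of_superset ht fun e he => chartAction_productAction σ a he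

omit [∀ j, IsManifold (I j) ∞ (Y j)] [FiniteDimensional 𝕜 g]
  [∀ j, FiniteDimensional 𝕜 (E j)] in
/-- The projection to two of the factors maps the mixed product to the two-fold mixed product. -/
theorem map_mfderiv_polyMixedProduct (B : LieBialgebra 𝕜 g) (b : Basis ι 𝕜 g)
    (π : ∀ j, ∀ y : Y j, Tensor2 𝕜 (TangentSpace (I j) y))
    (σ : ∀ j, B.Double →ₗ[𝕜] ∀ y : Y j, TangentSpace (I j) y) {j k : Fin n} (hjk : j < k)
    (y : ∀ i, Y i) :
    Tensor2.map
        (mfderiv (ModelWithCorners.pi I) ((I j).prod (I k))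
          (fun z : (∀ i, Y i) => (z j, z k)) y).toLinearMap
        (polyMixedProduct I B b π σ y) =
      mixedProduct (I j) (I k) B b (π j) (π k)
        (restrictRight (I j) B (σ j)) (restrictLeft (I k) B (σ k)) (y j, y k) := by
  let D : (∀ j, E j) →ₗ[𝕜] E j × E k := (LinearMap.proj j).prod (LinearMap.proj k)
  have hD : (mfderiv (ModelWithCorners.pi I) ((I j).prod (I k))
      (fun z : (∀ i, Y i) => (z j, z k)) y).toLinearMap = D := by
    rw [((hasMFDerivAt_apply y j).prodMk (hasMFDerivAt_apply y k)).mfderiv]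
    rfl
  rw [hD]
  let P : ∀ j, Tensor2 𝕜 (E j) := fun j => π j (y j)
  let X : ∀ j, B.Double → E j := fun j a => σ j a (y j)
  change Tensor2.map D (∑ j, Tensor2.map (LinearMap.single 𝕜 E j) (P j) -
    ∑ j, ∑ k ∈ Finset.Ioi j, ∑ i,
      wedge 𝕜 (LinearMap.single 𝕜 E j (-X j (B.inr (B.toDualLie (b.coord i)))))
        (LinearMap.single 𝕜 E k (X k (B.inl (b i))))) =
    Tensor2.map (LinearMap.inl 𝕜 (E j) (E k)) (P j) +
      Tensor2.map (LinearMap.inr 𝕜 (E j) (E k)) (P k) -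
    ∑ i, wedge 𝕜 (LinearMap.inl 𝕜 (E j) (E k) (-X j (B.inr (B.toDualLie (b.coord i)))))
        (LinearMap.inr 𝕜 (E j) (E k) (X k (B.inl (b i))))
  have h1 : ∀ v : E j, D (LinearMap.single 𝕜 E j v) = LinearMap.inl 𝕜 (E j) (E k) v := fun v =>
    Prod.ext (Pi.single_eq_same j v) (Pi.single_eq_of_ne hjk.ne' v)
  have h2 : ∀ v : E k, D (LinearMap.single 𝕜 E k v) = LinearMap.inr 𝕜 (E j) (E k) v := fun v =>
    Prod.ext (Pi.single_eq_of_ne hjk.ne v) (Pi.single_eq_same k v)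
  have h3 : ∀ l, l ≠ j → l ≠ k → ∀ v : E l, D (LinearMap.single 𝕜 E l v) = 0 :=
    fun l hj hk v => Prod.ext (Pi.single_eq_of_ne hj.symm v) (Pi.single_eq_of_ne hk.symm v)
  have hl : ∀ w : E j × E k, wedge 𝕜 0 w = 0 := fun w => by
    ext; simp [wedge]
  have hr : ∀ w : E j × E k, wedge 𝕜 w 0 = 0 := fun w => by
    ext; simp [wedge]
  simp only [Tensor2.map_sub, Tensor2.map_sum, Tensor2.map_map, Tensor2.map_wedge]
  congr 1
  · rw [← Finset.sum_subset (Finset.subset_univ {j, k}), Finset.sum_pair hjk.ne,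
      show D ∘ₗ LinearMap.single 𝕜 E j = _ from LinearMap.ext h1,
      show D ∘ₗ LinearMap.single 𝕜 E k = _ from LinearMap.ext h2]
    intro l _ hl
    simp only [Finset.mem_insert, Finset.mem_singleton, not_or] at hl
    rw [show D ∘ₗ LinearMap.single 𝕜 E l = 0 from LinearMap.ext (h3 l hl.1 hl.2)]
    refine LinearMap.ext fun α => LinearMap.ext fun β => ?_
    change P l (α ∘ₗ 0) (β ∘ₗ 0) = 0
    simp
  -- A wedge survives only if both its indices lie in {j, k}; since l < m and j < k, this forces l =
  -- j and m = k.
  · have hz : ∀ l m, l < m → (l ≠ j ∨ m ≠ k) → ∀ v w,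
        wedge 𝕜 (D (LinearMap.single 𝕜 E l v)) (D (LinearMap.single 𝕜 E m w)) = 0 := by
      intro l m hlm h v w
      by_cases hl' : l = j ∨ l = k
      · have hm : m ≠ j ∧ m ≠ k := by
          constructor <;> rintro rfl <;> rcases hl' with rfl | rfl <;> simp_all [lt_asymm]
        rw [h3 m hm.1 hm.2, hr]
      · rw [not_or] at hl'
        rw [h3 l hl'.1 hl'.2, hl]
    rw [Finset.sum_eq_single j, Finset.sum_eq_single k]
    · simp only [h1, h2]
    · intro m hm hmk
      exact Finset.sum_eq_zero fun i _ => hz j m (Finset.mem_Ioi.1 hm) (Or.inr hmk) _ _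
    · intro h
      exact absurd (Finset.mem_Ioi.2 hjk) h
    · intro l _ hlj
      exact Finset.sum_eq_zero fun m hm => Finset.sum_eq_zero fun i _ =>
        hz l m (Finset.mem_Ioi.1 hm) (Or.inl hlj) _ _
    · simp

end ManyFold

end PoissonLie

end

theorem mainTheorem8 {𝕜 : Type*} [RCLike 𝕜]
    {g : Type*} [LieRing g] [LieAlgebra 𝕜 g] [FiniteDimensional 𝕜 g] (B : LieBialgebra 𝕜 g)
    {ι : Type*} [Fintype ι] (b : Module.Basis ι 𝕜 g)
    {n : ℕ} (_hn : 2 ≤ n)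
    {E : Fin n → Type*} [∀ j, NormedAddCommGroup (E j)] [∀ j, NormedSpace 𝕜 (E j)]
    [∀ j, FiniteDimensional 𝕜 (E j)]
    {H : Fin n → Type*} [∀ j, TopologicalSpace (H j)]
    (I : ∀ j, ModelWithCorners 𝕜 (E j) (H j)) [∀ j, (I j).Boundaryless]
    {Y : Fin n → Type*} [∀ j, TopologicalSpace (Y j)] [∀ j, ChartedSpace (H j) (Y j)]
    [∀ j, IsManifold (I j) ∞ (Y j)]
    (π : ∀ j, ∀ y : Y j, Tensor2 𝕜 (TangentSpace (I j) y))
    (σ : ∀ j, B.Double →ₗ[𝕜] ∀ y : Y j, TangentSpace (I j) y)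
    (_h : ∀ j, IsLeftPoissonSpace (I j) B.doubleBialgebra (π j) (σ j)) :
    (∀ j, IsRightPoissonSpace (I j) B.dual (π j) (restrictRight (I j) B (σ j)) ∧
      IsLeftPoissonSpace (I j) B (π j) (restrictLeft (I j) B (σ j))) ∧
    IsLeftPoissonSpace (ModelWithCorners.pi I) (B.polyubleDouble n)
      (polyMixedProduct I B b π σ) (productAction I σ) ∧
    ∀ j k : Fin n, j < k → ∀ y : (∀ i, Y i),
      Tensor2.map
          (mfderiv (ModelWithCorners.pi I) ((I j).prod (I k))
            (fun z : (∀ i, Y i) => (z j, z k)) y).toLinearMap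
          (polyMixedProduct I B b π σ y) =
        mixedProduct (I j) (I k) B b (π j) (π k)
          (restrictRight (I j) B (σ j)) (restrictLeft (I k) B (σ k)) (y j, y k) := by
  exact ⟨fun j => ⟨(_h j).restrictRight, (_h j).restrictLeft⟩,
    isLeftPoissonSpace_polyMixedProduct B b _h,
    fun _ _ hjk y => map_mfderiv_polyMixedProduct B b π σ hjk y⟩
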